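/- Let $\mathfrak{M}$ denote the set of positive Radon measures $\mu$ on $[0,\infty)$ with $\int_{(0,\infty)} \frac{\mu(dr)}{1+r} < \infty$. Let $\rho > 0$, $0 < \alpha < 1$, $\gamma := 1 - \alpha/2$, and $c_a := \pi a/\sin(\pi a)$ for $0 < a < 1$. Let $l$ be a real function on $(0,\infty)$ that is slowly varying at infinity, i.e. $\lim_{x\to\infty} l(\lambda x)/l(x) = 1$ for every $\lambda > 0$. Write $f \sim_\infty g$ for $\lim_{x\to\infty} f(x)/g(x) = 1$ (real $x \to +\infty$). Let $\mu \in \mathfrak{M}$ satisfy $\mu([0,r]) \sim_\infty r^\alpha\, l(r)$, let $G(t) = \int_{[0,\infty)} e^{-tr}\,\mu(dr)$ for $t > 0$, and for $p > 0$ define $$Q(p) := p \int_0^\infty e^{-pt}\, G(t)\, dt, \qquad \kappa(p) := \rho^{1/2}\, p\, Q(p)^{-1/2}.$$ Then: 1. $G_0 := \lim_{t\to 0+} G(t) = \infty$. 2. $Q(p) \sim_\infty c_\alpha\, p^\alpha\, l(p)$. 3. $\kappa(p) \sim_\infty \rho^{1/2}\, c_\alpha^{-1/2}\, p^\gamma\,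 l(p)^{-1/2}$, and $1/2 < \gamma < 1$. 4. There exist $B \ge 0$ and $\nu \in \mathfrak{M}$ with $\nu(\{0\}) = 0$ such that $$\kappa(p) = B\, p + p \int_{(0,\infty)} \frac{\nu(dr)}{p + r} \qquad \text{for all } p > 0,$$ and for every such $B$ and $\nu$ the wavefront speed $c_\infty := 1/B \in (0,\infty]$ (with $1/0 := \infty$) equals $\infty$, and $$\nu([0,r]) \sim_\infty \rho^{1/2}\, c_\alpha^{-1/2}\, c_\gamma^{-1}\, r^\gamma\, l(r)^{-1/2}, \qquad c_\gamma = \frac{\pi\gamma}{\sin(\pi\gamma)}.$$ -/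

import Mathlib

open MeasureTheory Filter Topology Asymptotics

namespace Viscoelastic

noncomputable section

/-- The class `𝔐`: positive Radon measures on `[0,∞[` (regarded as measures on `ℝ` that do not
charge the negative half-line) with `∫_{]0,∞[} μ(dr)/(1+r) < ∞`. -/
structure MemM (μ : Measure ℝ) : Prop where
  locallyFinite : IsLocallyFiniteMeasure μ
  null_neg : μ (Set.Iio 0) = 0
  lintegral_lt_top : ∫⁻ r in Set.Ioi (0 : ℝ), ENNReal.ofReal (1 / (1 + r)) ∂μ < ⊤

/-- `l` is slowly varying at infinity (regularly varying of index `0`). -/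
def SlowlyVaryingAtTop (l : ℝ → ℝ) : Prop :=
  ∀ c : ℝ, 0 < c → Tendsto (fun x => l (c * x) / l x) atTop (𝓝 1)

/-- The Laplace transform `f̃(p) = ∫₀^∞ f(t) e^{-pt} dt`. -/
def laplace (f : ℝ → ℝ) (p : ℝ) : ℝ :=
  ∫ t in Set.Ioi (0 : ℝ), f t * Real.exp (-(p * t))

/-- `Q(p) = p G̃(p)` for a relaxation modulus `G`. -/
def Q (G : ℝ → ℝ) (p : ℝ) : ℝ := p * laplace G p

/-- The wave number function `κ(p) = ρ^{1/2} p / Q(p)^{1/2}` of a medium of density `ρ`. -/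
def kappa (ρ : ℝ) (G : ℝ → ℝ) (p : ℝ) : ℝ := √ρ * p / √(Q G p)

/-- `B ≥ 0` and the dispersion-attenuation spectral measure `ν ∈ 𝔐` on `]0,∞[` represent `κ`:
`κ(p) = B p + p ∫_{]0,∞[} ν(dr)/(p+r)` for all `p > 0`. -/
structure IsWaveNumberRep (ρ : ℝ) (G : ℝ → ℝ) (B : ℝ) (ν : Measure ℝ) : Prop where
  nonneg : 0 ≤ B
  memM : MemM ν
  null_zero : ν {0} = 0
  kappa_eq : ∀ p : ℝ, 0 < p → kappa ρ G p = B * p + p * ∫ r in Set.Ioi (0 : ℝ), 1 / (p + r) ∂ν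

/-- The wavefront speed `c_∞ = 1/B ∈ ]0,∞]`, with `1/0 = ∞`. -/
def wavefrontSpeed (B : ℝ) : ENNReal := (ENNReal.ofReal B)⁻¹

/-- The constant `c_a = πa / sin(πa)`. -/
def cst (a : ℝ) : ℝ := Real.pi * a / Real.sin (Real.pi * a)

end

end Viscoelastic

/-! Write S_μ(p) = ∫ μ(dr)/(p + r). Fubini gives Q(p) = p S_μ(p), so every claim concerns Stieltjes
transforms of measures on [0, ∞).

Asymptotics of Q are Karamata's Abelian theorem. With F(r) = μ([0, r]), p S_μ(p) = ∫ F(ps) (1 + s)⁻²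
ds; divide by F(p) and pass to the limit under a Potter bound (`potter_bound`). The limit ∫ s^α (1 +
s)⁻² ds is c_α. The function F is monotone and regularly varying of positive index, hence unbounded,
which forces G(0+) = ∞ and Q → ∞. Taking the power -1/2 gives κ.

Existence of B and ν says that Q^(-1/2) is a constant plus a Stieltjes transform. In the variable u
= 1/(1 + r), such functions are, up to normalisation, means of 1/(1 - u + cu) over probability
measures on [0, 1], a class closed under mixtures and, by weak compactness, under pointwise limits.
A negative power q^(a-1) is a mixture of the functions 1/(1 - t + tq), so it suffices to treat these
with q = c ∫ dσ(u)/(1 - u + cu). For finitely supported σ this is a diagonal resolvent entry of a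
symmetric matrix between 0 and 1 (a Schur complement), and the spectral theorem supplies the measure
(`isStieltjesMean_inv_of_finite`).

Given any representation, B ≤ κ(p)/p = √ρ Q(p)^(-1/2) → 0, so B = 0 and S_ν = √ρ Q^(-1/2) is
regularly varying of index γ - 1. The Tauberian theorem
(`StieltjesIntegrable.tendsto_measureReal_div`) recovers ν([0, r]): rescaled measures on [0, 1] lie
in a compact space, their limit points are determined by kernel integrals, and the limit is the one
obtained from an explicit power-law measure. -/

/-! ### Stieltjes transforms and distribution functions. -/

/-- Measures on `[0, ∞)` whose Stieltjes transform converges. -/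
structure StieltjesIntegrable (μ : Measure ℝ) : Prop where
  null_neg : μ (Set.Iio 0) = 0
  integrable : Integrable (fun r : ℝ => (1 + r)⁻¹) μ

/-- The Stieltjes transform of a measure on `[0, ∞)`. -/
noncomputable def stieltjesTransform (μ : Measure ℝ) (p : ℝ) : ℝ := ∫ r, (p + r)⁻¹ ∂μ

namespace StieltjesIntegrable

variable {μ : Measure ℝ}

theorem ae_nonneg (h : StieltjesIntegrable μ) : ∀ᵐ r ∂μ, 0 ≤ r := by
  rw [ae_iff]
  convert h.null_neg using 2
  ext r; simp

theorem integrable_inv_add (h : StieltjesIntegrable μ) {p : ℝ} (hp : 0 < p) :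
    Integrable (fun r : ℝ => (p + r)⁻¹) μ := by
  refine (h.integrable.const_mul (max 1 p⁻¹)).mono' (by fun_prop) ?_
  filter_upwards [h.ae_nonneg] with r hr
  have h1 : (0 : ℝ) < 1 + r := by linarith
  have h2 : 0 < p + r := by linarith
  rw [Real.norm_of_nonneg (by positivity), ← div_eq_mul_inv, inv_eq_one_div,
    div_le_div_iff₀ h2 h1]
  have h3 : 1 ≤ max 1 p⁻¹ := le_max_left _ _
  have h4 : p⁻¹ ≤ max 1 p⁻¹ := le_max_right _ _
  have h5 : p⁻¹ * p = 1 := inv_mul_cancel₀ hp.ne'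
  nlinarith

/-- Markov's inequality: the integrable weight is at least (1 + r)⁻¹ on the interval. -/
theorem measure_Icc_lt_top (h : StieltjesIntegrable μ) (r : ℝ) : μ (Set.Icc 0 r) < ⊤ := by
  rcases lt_or_ge r 0 with hr | hr
  · simp [Set.Icc_eq_empty (not_le.2 hr)]
  have := (h.integrable.measure_norm_ge_lt_top (ε := (1 + r)⁻¹) (by positivity))
  refine lt_of_le_of_lt (measure_mono ?_) this
  intro s hs
  have h1 : (0 : ℝ) < 1 + s := by linarith [hs.1]
  simp only [Set.mem_ofPred_eq]
  rw [Real.norm_of_nonneg (by positivity)]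
  exact inv_anti₀ h1 (by linarith [hs.2])

theorem stieltjesTransform_nonneg (h : StieltjesIntegrable μ) {p : ℝ} (hp : 0 < p) :
    0 ≤ stieltjesTransform μ p := by
  refine integral_nonneg_of_ae ?_
  filter_upwards [h.ae_nonneg] with r hr
  have : 0 < p + r := by linarith
  simp only [Pi.zero_apply]; positivity

theorem stieltjesTransform_pos (h : StieltjesIntegrable μ) (hμ : μ ≠ 0) {p : ℝ} (hp : 0 < p) :
    0 < stieltjesTransform μ p := by
  refine (h.stieltjesTransform_nonneg hp).lt_of_ne' fun h0 => hμ ?_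
  have hnn : 0 ≤ᵐ[μ] fun r : ℝ => (p + r)⁻¹ := by
    filter_upwards [h.ae_nonneg] with r hr
    have : 0 < p + r := by linarith
    simp only [Pi.zero_apply]; positivity
  have := (integral_eq_zero_iff_of_nonneg_ae hnn (h.integrable_inv_add hp)).1 h0
  rw [← ae_eq_bot, ← Filter.eventually_false_iff_eq_bot]
  filter_upwards [this, h.ae_nonneg] with r hr hr0
  have h1 : 0 < p + r := by linarith
  have : (0:ℝ) < (p + r)⁻¹ := by positivity
  rw [hr] at this
  exact lt_irrefl _ this

/-- The Stieltjes transform is the iterated Laplace transform. -/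
theorem integral_exp_mul_exp [SFinite μ] (h : StieltjesIntegrable μ) {p : ℝ} (hp : 0 < p) :
    ∫ t in Set.Ioi (0 : ℝ), (∫ r, Real.exp (-(t * r)) ∂μ) * Real.exp (-(p * t))
      = stieltjesTransform μ p := by
  have key : ∀ r : ℝ, 0 ≤ r →
      ∫ t in Set.Ioi (0 : ℝ), Real.exp (-(t * r)) * Real.exp (-(p * t)) = (p + r)⁻¹ := by
    intro r hr
    have h1 : 0 < p + r := by linarith
    calc _ = ∫ t in Set.Ioi (0 : ℝ), Real.exp (-(p + r) * t) := by
          congr 1; ext t; rw [← Real.exp_add]; congr 1; ring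
      _ = _ := by 
            rw [integral_exp_mul_Ioi (by linarith)]
            rw [mul_zero, Real.exp_zero, div_neg, neg_div, neg_neg, one_div]
  have hint : ∀ r : ℝ, 0 ≤ r →
      IntegrableOn (fun t : ℝ => Real.exp (-(t * r)) * Real.exp (-(p * t))) (Set.Ioi 0) := by
    intro r hr
    have := integrableOn_exp_mul_Ioi (a := -(p + r)) (by linarith) 0
    refine this.congr_fun (fun t _ => ?_) measurableSet_Ioi
    simp only
    rw [← Real.exp_add]; congr 1; ring
  simp_rw [← integral_mul_const]
  rw [integral_integral_swap]
  · unfold stieltjesTransform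
    refine integral_congr_ae ?_
    filter_upwards [h.ae_nonneg] with r hr using key r hr
  · rw [integrable_prod_iff' (by
      apply Continuous.aestronglyMeasurable
      simp only [Function.uncurry_def]
      fun_prop)]
    refine ⟨?_, ?_⟩
    · filter_upwards [h.ae_nonneg] with r hr using hint r hr
    · refine (h.integrable_inv_add hp).congr ?_
      filter_upwards [h.ae_nonneg] with r hr
      rw [← key r hr]
      refine integral_congr_ae (ae_of_all _ fun t => ?_)
      simp only [Function.uncurry]
      rw [Real.norm_of_nonneg (by positivity)]

theorem measureReal_Icc_mono (h : StieltjesIntegrable μ) :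
    Monotone fun r : ℝ => μ.real (Set.Icc 0 r) := fun _ s hrs =>
  measureReal_mono (Set.Icc_subset_Icc_right hrs) (h.measure_Icc_lt_top s).ne

/-- The Stieltjes transform in terms of the distribution function. -/
theorem mul_stieltjesTransform_eq_integral [SFinite μ] (h : StieltjesIntegrable μ) {p : ℝ}
    (hp : 0 < p) :
    p * stieltjesTransform μ p
      = ∫ s in Set.Ioi (0 : ℝ), μ.real (Set.Icc 0 (p * s)) * ((1 + s) ^ 2)⁻¹ := by
  -- Layer-cake argument: p/(p + r) = ∫ over s > r/p of (1 + s)⁻² ds, then Tonelli on the region r ≤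
  -- ps. Here `hder` is the inner integral in s and `hF` the one in r.
  have hm : Measurable fun q : ℝ × ℝ => Set.indicator {q : ℝ × ℝ | q.1 ≤ p * q.2}
      (fun q => ENNReal.ofReal (((1 + q.2) ^ 2)⁻¹)) q := by
    refine Measurable.indicator (by fun_prop) (measurableSet_le (by fun_prop) (by fun_prop))
  have hder : ∀ r : ℝ, 0 ≤ r →
      ∫⁻ s in Set.Ioi (0 : ℝ), Set.indicator {q : ℝ × ℝ | q.1 ≤ p * q.2}
      (fun q => ENNReal.ofReal (((1 + q.2) ^ 2)⁻¹)) (r, s) = ENNReal.ofReal (p * (p + r)⁻¹) := by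
    intro r hr
    have hrp : 0 ≤ r / p := by positivity
    have e1 : ∀ s : ℝ, Set.indicator {q : ℝ × ℝ | q.1 ≤ p * q.2}
      (fun q => ENNReal.ofReal (((1 + q.2) ^ 2)⁻¹)) (r, s)
        = Set.indicator (Set.Ici (r / p)) (fun s => ENNReal.ofReal (((1 + s) ^ 2)⁻¹)) s := by
      intro s
      simp only [Set.indicator, Set.mem_ofPred_eq, Set.mem_Ici, div_le_iff₀ hp, mul_comm s p]
    simp_rw [e1]
    rw [lintegral_indicator measurableSet_Ici, Measure.restrict_restrict measurableSet_Ici]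
    have e2 : (volume : Measure ℝ).restrict (Set.Ici (r / p) ∩ Set.Ioi 0)
        = volume.restrict (Set.Ioi (r / p)) := by
      refine Measure.restrict_congr_set ?_
      have : (Set.Ioi (r / p) : Set ℝ) = Set.Ioi (r / p) ∩ Set.Ioi 0 := by
        rw [Set.inter_eq_left.2]; exact Set.Ioi_subset_Ioi hrp
      rw [this]
      exact (Ioi_ae_eq_Ici.symm).inter (ae_eq_refl _)
    rw [e2]
    have hd : ∀ x ∈ Set.Ici (r / p), HasDerivAt (fun s : ℝ => -(1 + s)⁻¹) (((1 + x) ^ 2)⁻¹) x := by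
      intro x hx
      have hx0 : (0 : ℝ) < 1 + x := by linarith [hrp.trans hx]
      refine HasDerivAt.congr_deriv (f := fun s : ℝ => -(1 + s)⁻¹)
        (((hasDerivAt_id x).const_add 1).inv hx0.ne').neg ?_
      rw [neg_div, neg_neg, one_div]
      rfl
    have hlim : Tendsto (fun s : ℝ => -(1 + s)⁻¹) atTop (𝓝 0) := by
      rw [← neg_zero]
      exact (tendsto_inv_atTop_zero.comp (tendsto_atTop_add_const_left _ _ tendsto_id)).neg
    have hnn : ∀ x ∈ Set.Ioi (r / p), (0 : ℝ) ≤ ((1 + x) ^ 2)⁻¹ := fun x _ => by positivity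
    rw [← ofReal_integral_eq_lintegral_ofReal (integrableOn_Ioi_deriv_of_nonneg' hd hnn hlim)
      (ae_of_all _ fun x => by positivity), integral_Ioi_of_hasDerivAt_of_nonneg' hd hnn hlim]
    congr 1
    have : 0 < p + r := by linarith
    field_simp
    ring
  have hF : ∀ s : ℝ, ∫⁻ r, Set.indicator {q : ℝ × ℝ | q.1 ≤ p * q.2}
      (fun q => ENNReal.ofReal (((1 + q.2) ^ 2)⁻¹)) (r, s) ∂μ
      = ENNReal.ofReal (μ.real (Set.Icc 0 (p * s)) * ((1 + s) ^ 2)⁻¹) := by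
    intro s
    have e1 : ∀ r : ℝ, Set.indicator {q : ℝ × ℝ | q.1 ≤ p * q.2}
      (fun q => ENNReal.ofReal (((1 + q.2) ^ 2)⁻¹)) (r, s)
        = Set.indicator (Set.Iic (p * s)) (fun _ => ENNReal.ofReal (((1 + s) ^ 2)⁻¹)) r := by
      intro r
      simp only [Set.indicator, Set.mem_ofPred_eq, Set.mem_Iic]
    simp_rw [e1]
    rw [lintegral_indicator measurableSet_Iic, lintegral_const, Measure.restrict_apply_univ,
      mul_comm, ENNReal.ofReal_mul measureReal_nonneg, measureReal_def,
      ENNReal.ofReal_toReal (h.measure_Icc_lt_top _).ne]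
    congr 1
    refine measure_congr ?_
    filter_upwards [h.ae_nonneg] with r hr
    exact propext ⟨fun h => ⟨hr, h⟩, fun h => h.2⟩
  have hpos : 0 ≤ᵐ[μ] fun r : ℝ => p * (p + r)⁻¹ := by
    filter_upwards [h.ae_nonneg] with r hr
    have : 0 < p + r := by linarith
    simp only [Pi.zero_apply]; positivity
  unfold stieltjesTransform
  have hFm : Measurable fun s : ℝ => μ.real (Set.Icc 0 (p * s)) :=
    (h.measureReal_Icc_mono.comp (monotone_id.const_mul hp.le)).measurable
  rw [← integral_const_mul, integral_eq_lintegral_of_nonneg_ae hpos (by fun_prop),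
    integral_eq_lintegral_of_nonneg_ae (ae_of_all _ fun s => by
      simp only [Pi.zero_apply]; positivity)
      (by fun_prop)]
  congr 1
  simp_rw [← hF]
  rw [← lintegral_lintegral_swap hm.aemeasurable]
  refine lintegral_congr_ae ?_
  filter_upwards [h.ae_nonneg] with r hr using (hder r hr).symm

end StieltjesIntegrable

/-! ### The power-law model measure. -/

/-- The measure `sin (π a) / π * s ^ (a - 1) ds` on `(0, ∞)`, with Stieltjes transform
`p ^ (a - 1)`. -/
noncomputable def powerMeasure (a : ℝ) : Measure ℝ :=
  (volume.restrict (Set.Ioi 0)).withDensity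
    fun s => ENNReal.ofReal (Real.sin (Real.pi * a) / Real.pi * s ^ (a - 1))

instance (a : ℝ) : SFinite (powerMeasure a) := by
  unfold powerMeasure; infer_instance

section powerMeasure

variable {a : ℝ}

theorem sin_pi_mul_div_pi_pos (h0 : 0 < a) (h1 : a < 1) :
    0 < Real.sin (Real.pi * a) / Real.pi := by
  have := Real.pi_pos
  refine div_pos (Real.sin_pos_of_pos_of_lt_pi (by positivity) ?_) this
  nlinarith

theorem integral_powerMeasure (h0 : 0 < a) (h1 : a < 1) (f : ℝ → ℝ) :
    ∫ s, f s ∂(powerMeasure a)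
      = ∫ s in Set.Ioi (0 : ℝ), Real.sin (Real.pi * a) / Real.pi * s ^ (a - 1) * f s := by
  unfold powerMeasure
  rw [integral_withDensity_eq_integral_toReal_smul (by fun_prop)
    (ae_of_all _ fun _ => ENNReal.ofReal_lt_top)]
  refine setIntegral_congr_fun measurableSet_Ioi fun s hs => ?_
  have := sin_pi_mul_div_pi_pos h0 h1
  have hs' : 0 < s := hs
  simp only [smul_eq_mul]
  rw [ENNReal.toReal_ofReal (by positivity)]

theorem integrable_powerMeasure_iff (h0 : 0 < a) (h1 : a < 1) (f : ℝ → ℝ) :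
    Integrable f (powerMeasure a) ↔ IntegrableOn
      (fun s => Real.sin (Real.pi * a) / Real.pi * s ^ (a - 1) * f s) (Set.Ioi 0) := by
  unfold powerMeasure
  rw [integrable_withDensity_iff_integrable_smul' (by fun_prop)
    (ae_of_all _ fun _ => ENNReal.ofReal_lt_top)]
  refine integrableOn_congr_fun (fun s hs => ?_) measurableSet_Ioi
  have := sin_pi_mul_div_pi_pos h0 h1
  have hs' : 0 < s := hs
  simp only [smul_eq_mul]
  rw [ENNReal.toReal_ofReal (by positivity)]

theorem stieltjesIntegrable_powerMeasure (h0 : 0 < a) (h1 : a < 1) :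
    StieltjesIntegrable (powerMeasure a) where
  null_neg := by
    unfold powerMeasure
    rw [withDensity_apply _ measurableSet_Iio, Measure.restrict_restrict measurableSet_Iio]
    have : Set.Iio (0 : ℝ) ∩ Set.Ioi 0 = ∅ := by
      ext x; simp only [Set.mem_inter_iff, Set.mem_Iio, Set.mem_Ioi, Set.mem_empty_iff_false]
      constructor
      · rintro ⟨h, h'⟩; exact lt_asymm h h'
      · simp
    rw [this]; simp
  integrable := by
    rw [integrable_powerMeasure_iff h0 h1]
    simp_rw [mul_assoc]
    refine Integrable.const_mul ?_ _
    rw [← IntegrableOn, ← Set.Ioc_union_Ioi_eq_Ioi (zero_le_one (α := ℝ))]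
    refine IntegrableOn.union ?_ ?_
    · have : IntegrableOn (fun s : ℝ => s ^ (a - 1)) (Set.Ioc 0 1) := by
        rw [← intervalIntegrable_iff_integrableOn_Ioc_of_le zero_le_one]
        exact intervalIntegral.intervalIntegrable_rpow' (by linarith)
      refine this.mono' (by fun_prop) ?_
      filter_upwards [ae_restrict_mem measurableSet_Ioc] with s hs
      have hs0 : 0 < s := hs.1
      rw [Real.norm_of_nonneg (by positivity)]
      refine mul_le_of_le_one_right (by positivity) (inv_le_one_of_one_le₀ (by linarith))
    · refine (integrableOn_Ioi_rpow_of_lt (a := a - 2) (by linarith) one_pos).mono'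
        (by fun_prop) ?_
      filter_upwards [ae_restrict_mem measurableSet_Ioi] with s hs
      have hs0 : (0 : ℝ) < s := one_pos.trans hs
      rw [Real.norm_of_nonneg (by positivity)]
      have : s ^ (a - 2) = s ^ (a - 1) * s⁻¹ := by
        rw [← Real.rpow_neg_one, ← Real.rpow_add hs0]; congr 1; ring
      rw [this]
      gcongr
      linarith

/-- Two Gamma integrals, through the iterated Laplace transform; the reflection formula for Γ(a) Γ(1
- a) cancels the normalising constant. -/
theorem stieltjesTransform_powerMeasure (h0 : 0 < a) (h1 : a < 1) {p : ℝ} (hp : 0 < p) :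
    stieltjesTransform (powerMeasure a) p = p ^ (a - 1) := by
  rw [← (stieltjesIntegrable_powerMeasure h0 h1).integral_exp_mul_exp hp]
  have e1 : ∀ t ∈ Set.Ioi (0 : ℝ),
      (∫ r, Real.exp (-(t * r)) ∂(powerMeasure a)) * Real.exp (-(p * t))
      = Real.sin (Real.pi * a) / Real.pi * Real.Gamma a
        * (t ^ ((1 - a) - 1) * Real.exp (-(p * t))) := by
    intro t ht
    have ht : 0 < t := ht
    rw [integral_powerMeasure h0 h1]
    simp_rw [mul_assoc]
    rw [integral_const_mul, Real.integral_rpow_mul_exp_neg_mul_Ioi h0 ht,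
      one_div, Real.inv_rpow ht.le, ← Real.rpow_neg ht.le]
    have : 1 - a - 1 = -a := by ring
    rw [this]; ring
  rw [setIntegral_congr_fun measurableSet_Ioi e1, integral_const_mul,
    Real.integral_rpow_mul_exp_neg_mul_Ioi (by linarith) hp]
  have hsin := sin_pi_mul_div_pi_pos h0 h1
  have hG := Real.Gamma_mul_Gamma_one_sub a
  have hs : Real.sin (Real.pi * a) ≠ 0 := by
    intro h; rw [h] at hsin; simp at hsin
  calc _ = Real.sin (Real.pi * a) / Real.pi * (Real.Gamma a * Real.Gamma (1 - a))
        * (1 / p) ^ (1 - a) := by ring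
    _ = (1 / p) ^ (1 - a) := by
        rw [hG]
        have := Real.pi_ne_zero
        field_simp
    _ = p ^ (a - 1) := by
        rw [one_div, Real.inv_rpow hp.le, ← Real.rpow_neg hp.le]; congr 1; ring

theorem measureReal_Icc_powerMeasure (h0 : 0 < a) (h1 : a < 1) {r : ℝ} (hr : 0 ≤ r) :
    (powerMeasure a).real (Set.Icc 0 r) = (Viscoelastic.cst a)⁻¹ * r ^ a := by
  have : (powerMeasure a).real (Set.Icc 0 r)
      = ∫ s, Set.indicator (Set.Icc 0 r) (fun _ => (1 : ℝ)) s ∂(powerMeasure a) := by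
    rw [integral_indicator measurableSet_Icc]; simp
  rw [this, integral_powerMeasure h0 h1]
  have e : ∀ s : ℝ, Real.sin (Real.pi * a) / Real.pi * s ^ (a - 1)
      * Set.indicator (Set.Icc 0 r) (fun _ => (1 : ℝ)) s
      = Set.indicator (Set.Icc 0 r) (fun s => Real.sin (Real.pi * a) / Real.pi * s ^ (a - 1)) s := by
    intro s; by_cases h : s ∈ Set.Icc 0 r <;> simp [h]
  simp_rw [e]
  rw [setIntegral_indicator measurableSet_Icc]
  have e2 : Set.Ioi (0 : ℝ) ∩ Set.Icc 0 r = Set.Ioc 0 r := by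
    ext x; simp only [Set.mem_inter_iff, Set.mem_Ioi, Set.mem_Icc, Set.mem_Ioc]
    constructor
    · rintro ⟨h, h', h''⟩; exact ⟨h, h''⟩
    · rintro ⟨h, h'⟩; exact ⟨h, h.le, h'⟩
  rw [e2, integral_const_mul, ← intervalIntegral.integral_of_le hr,
    integral_rpow (Or.inl (by linarith))]
  simp only [sub_add_cancel, Real.zero_rpow h0.ne', sub_zero, Viscoelastic.cst]
  rw [inv_div]
  field_simp

/-- No direct evaluation is needed: for the power-law measure at p = 1, both the transform and the
distribution function are known, and the formula linking them yields the integral. -/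
theorem integral_rpow_div_one_add_sq (h0 : 0 < a) (h1 : a < 1) :
    ∫ s in Set.Ioi (0 : ℝ), s ^ a * ((1 + s) ^ 2)⁻¹ = Viscoelastic.cst a := by
  have h := (stieltjesIntegrable_powerMeasure h0 h1).mul_stieltjesTransform_eq_integral one_pos
  rw [stieltjesTransform_powerMeasure h0 h1 one_pos] at h
  simp only [Real.one_rpow, one_mul] at h
  have e : ∀ s ∈ Set.Ioi (0 : ℝ), (powerMeasure a).real (Set.Icc 0 s) * ((1 + s) ^ 2)⁻¹
      = (Viscoelastic.cst a)⁻¹ * (s ^ a * ((1 + s) ^ 2)⁻¹) := by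
    intro s hs
    rw [measureReal_Icc_powerMeasure h0 h1 (le_of_lt hs), mul_assoc]
  rw [setIntegral_congr_fun measurableSet_Ioi e, integral_const_mul] at h
  have hc : Viscoelastic.cst a ≠ 0 := by
    intro h'; rw [h'] at h; simp at h
  field_simp at h
  exact h.symm

theorem cst_pos (h0 : 0 < a) (h1 : a < 1) : 0 < Viscoelastic.cst a := by
  have := sin_pi_mul_div_pi_pos h0 h1
  have hp := Real.pi_pos
  have hs : 0 < Real.sin (Real.pi * a) := by
    rwa [div_pos_iff_of_pos_right hp] at this
  unfold Viscoelastic.cst; positivity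

end powerMeasure

/-! ### Regular variation and Potter-type bounds. -/

/-- `f` is regularly varying at infinity of index `a`. -/
def RegularlyVarying (f : ℝ → ℝ) (a : ℝ) : Prop :=
  ∀ c : ℝ, 0 < c → Tendsto (fun x => f (c * x) / f x) atTop (𝓝 (c ^ a))

namespace RegularlyVarying

variable {f g : ℝ → ℝ} {a b : ℝ}

theorem eventually_ne_zero (h : RegularlyVarying f a) : ∀ᶠ x in atTop, f x ≠ 0 := by
  have h1 := h 1 one_pos
  simp only [one_mul, Real.one_rpow] at h1
  filter_upwards [h1.eventually_ne one_ne_zero] with x hx h0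
  simp [h0] at hx

theorem of_isEquivalent (hg : RegularlyVarying g a) (hfg : f ~[atTop] g) :
    RegularlyVarying f a := by
  intro c hc
  have h1 : (fun x => f (c * x)) ~[atTop] fun x => g (c * x) :=
    hfg.comp_tendsto (tendsto_id.const_mul_atTop hc)
  exact (h1.div hfg).symm.tendsto_nhds (hg c hc)

theorem of_tendsto_div (hg : RegularlyVarying g a) {k : ℝ} (hk : k ≠ 0)
    (hfg : Tendsto (fun x => f x / g x) atTop (𝓝 k)) : RegularlyVarying f a := by
  intro c hc
  have h1 := ((hfg.comp (tendsto_id.const_mul_atTop hc)).div hfg hk).mul (hg c hc)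
  rw [div_self hk, one_mul] at h1
  refine h1.congr' ?_
  filter_upwards [hg.eventually_ne_zero,
    (tendsto_id.const_mul_atTop hc).eventually hg.eventually_ne_zero] with x hx hx'
  simp only [Pi.div_apply, Function.comp, id] at hx' ⊢
  rcases eq_or_ne (f x) 0 with h0 | h0
  · simp [h0]
  · field_simp

theorem rpow_mul {l : ℝ → ℝ} (hl : Viscoelastic.SlowlyVaryingAtTop l) (a : ℝ) :
    RegularlyVarying (fun x => x ^ a * l x) a := by
  intro c hc
  have := (hl c hc).const_mul (c ^ a)
  rw [mul_one] at this
  refine this.congr' ?_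
  filter_upwards [eventually_gt_atTop 0] with x hx
  have : x ^ a ≠ 0 := (Real.rpow_pos_of_pos hx a).ne'
  rw [Real.mul_rpow hc.le hx.le]
  field_simp

theorem rpow (hf : RegularlyVarying f a) (hpos : ∀ᶠ x in atTop, 0 < f x) (b : ℝ) :
    RegularlyVarying (fun x => f x ^ b) (a * b) := by
  intro c hc
  have hca := Real.rpow_pos_of_pos hc a
  have := (hf c hc).rpow_const (p := b) (Or.inl hca.ne')
  rw [← Real.rpow_mul hc.le] at this
  refine this.congr' ?_
  filter_upwards [hpos, (tendsto_id.const_mul_atTop hc).eventually hpos] with x hx hx'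
  exact Real.div_rpow hx'.le hx.le b

theorem const_mul (hf : RegularlyVarying f a) {k : ℝ} (hk : k ≠ 0) :
    RegularlyVarying (fun x => k * f x) a := by
  intro c hc
  refine (hf c hc).congr fun x => ?_
  rw [mul_div_mul_left _ _ hk]

/-- Since b > a, f(2x) ≤ 2^b f(x) for all x beyond some x₀; iterate along powers of 2 and
interpolate by monotonicity, with 2^n ≤ 1 + s < 2^(n+1). The threshold on x does not depend on s, as
dominated convergence requires. -/
theorem potter_bound (hf : RegularlyVarying f a) (hmono : Monotone f)
    (hpos : ∀ᶠ x in atTop, 0 < f x) (hab : a < b) (hb : 0 ≤ b) :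
    ∀ᶠ x in atTop, ∀ s : ℝ, 0 ≤ s → f (x * s) ≤ 2 ^ b * (1 + s) ^ b * f x := by
  have h2 : (2 : ℝ) ^ a < 2 ^ b := Real.rpow_lt_rpow_of_exponent_lt one_lt_two hab
  obtain ⟨x₀, hx₀⟩ := eventually_atTop.1
    (((hf 2 two_pos).eventually_lt_const h2).and (hpos.and (eventually_gt_atTop 0)))
  have hstep : ∀ n : ℕ, ∀ x, x₀ ≤ x → f (2 ^ n * x) ≤ ((2 : ℝ) ^ b) ^ n * f x := by
    intro n
    induction n with
    | zero => intro x _; simp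
    | succ n ih =>
      intro x hx
      have h3 := (hx₀ x hx).1
      have h4 := (hx₀ x hx).2.1
      have h5 := (hx₀ x hx).2.2
      rw [div_lt_iff₀ h4] at h3
      have := ih (2 * x) (by linarith)
      calc f (2 ^ (n + 1) * x) = f (2 ^ n * (2 * x)) := by congr 1; ring
        _ ≤ ((2 : ℝ) ^ b) ^ n * f (2 * x) := this
        _ ≤ ((2 : ℝ) ^ b) ^ n * (2 ^ b * f x) := by gcongr
        _ = _ := by ring
  filter_upwards [eventually_ge_atTop x₀] with x hx s hs
  obtain ⟨n, hn1, hn2⟩ := exists_nat_pow_near (x := 1 + s) (y := (2 : ℝ)) (by linarith) one_lt_two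
  have h4 := (hx₀ x hx).2.1
  have h5 := (hx₀ x hx).2.2
  calc f (x * s) ≤ f (2 ^ (n + 1) * x) := hmono (by nlinarith)
    _ ≤ ((2 : ℝ) ^ b) ^ (n + 1) * f x := hstep _ x hx
    _ = 2 ^ b * ((2 : ℝ) ^ n) ^ b * f x := by
        rw [pow_succ, ← Real.rpow_natCast, ← Real.rpow_mul two_pos.le, mul_comm b,
          Real.rpow_mul two_pos.le, Real.rpow_natCast]
        ring
    _ ≤ 2 ^ b * (1 + s) ^ b * f x := by gcongr

/-- For 1 < c < 2^a, doubling the argument eventually multiplies f by more than c, so f grows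
geometrically along 2^n x₀. -/
theorem tendsto_atTop_of_monotone (hf : RegularlyVarying f a) (hmono : Monotone f)
    (hpos : ∀ᶠ x in atTop, 0 < f x) (ha : 0 < a) : Tendsto f atTop atTop := by
  obtain ⟨c, hc1, hc2⟩ := exists_between (Real.one_lt_rpow one_lt_two ha)
  obtain ⟨x₀, hx₀⟩ := eventually_atTop.1
    (((hf 2 two_pos).eventually_const_lt hc2).and (hpos.and (eventually_gt_atTop 0)))
  have hstep : ∀ n : ℕ, c ^ n * f x₀ ≤ f (2 ^ n * x₀) := by
    intro n
    induction n with
    | zero => simp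
    | succ n ih =>
      have h5 := (hx₀ x₀ le_rfl).2.2
      have hge : x₀ ≤ 2 ^ n * x₀ :=
        le_mul_of_one_le_left h5.le (one_le_pow₀ one_le_two)
      have h3 := (hx₀ _ hge).1
      rw [lt_div_iff₀ (hx₀ _ hge).2.1] at h3
      calc c ^ (n + 1) * f x₀ = c * (c ^ n * f x₀) := by ring
        _ ≤ c * f (2 ^ n * x₀) := by gcongr
        _ ≤ f (2 * (2 ^ n * x₀)) := h3.le
        _ = _ := by congr 1; ring
  refine tendsto_atTop_atTop_of_monotone hmono fun y => ?_
  have h4 := (hx₀ x₀ le_rfl).2.1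
  obtain ⟨n, hn⟩ := ((tendsto_pow_atTop_atTop_of_one_lt hc1).atTop_mul_const h4
    |>.eventually_ge_atTop y).exists
  exact ⟨_, hn.trans (hstep n)⟩

end RegularlyVarying

/-! ### The Abelian theorem. -/

/-- Karamata's Abelian theorem for the Stieltjes transform. -/
theorem StieltjesIntegrable.tendsto_mul_stieltjesTransform_div {μ : Measure ℝ} [SFinite μ]
    (h : StieltjesIntegrable μ) {a : ℝ} (h0 : 0 < a) (h1 : a < 1)
    (hF : RegularlyVarying (fun r => μ.real (Set.Icc 0 r)) a) :
    Tendsto (fun p => p * stieltjesTransform μ p / μ.real (Set.Icc 0 p)) atTop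
      (𝓝 (Viscoelastic.cst a)) := by
  have hpos : ∀ᶠ x in atTop, 0 < μ.real (Set.Icc 0 x) :=
    hF.eventually_ne_zero.mono fun x hx => lt_of_le_of_ne measureReal_nonneg hx.symm
  -- The Potter exponent must exceed a and stay below 1, so that the majorant (1 + s)^(b-2) is
  -- integrable.
  obtain ⟨b, hab, hb1⟩ := exists_between h1
  have hb0 : 0 < b := h0.trans hab
  have hint : IntegrableOn (fun s : ℝ => 2 ^ b * (1 + s) ^ (b - 2)) (Set.Ioi 0) := by
    have := (integrableOn_add_rpow_Ioi_of_lt (a := b - 2) (c := 0) (m := 1) (by linarith)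
      (by norm_num)).const_mul (2 ^ b)
    simpa only [add_comm, IntegrableOn] using this
  have key := tendsto_integral_filter_of_dominated_convergence (l := atTop)
    (μ := volume.restrict (Set.Ioi (0 : ℝ)))
    (F := fun p s => μ.real (Set.Icc 0 (p * s)) / μ.real (Set.Icc 0 p) * ((1 + s) ^ 2)⁻¹)
    (f := fun s => s ^ a * ((1 + s) ^ 2)⁻¹) (fun s => 2 ^ b * (1 + s) ^ (b - 2)) ?_ ?_ hint ?_
  · rw [integral_rpow_div_one_add_sq h0 h1] at key
    refine key.congr' ?_
    filter_upwards [eventually_gt_atTop 0] with p hp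
    rw [h.mul_stieltjesTransform_eq_integral hp, ← integral_div]
    congr 1; ext s; ring
  · filter_upwards [eventually_gt_atTop 0] with p hp
    have hFm : Measurable fun s : ℝ => μ.real (Set.Icc 0 (p * s)) :=
      (h.measureReal_Icc_mono.comp (monotone_id.const_mul hp.le)).measurable
    fun_prop
  · filter_upwards [hF.potter_bound h.measureReal_Icc_mono hpos hab hb0.le, hpos] with p hp hp0
    filter_upwards [ae_restrict_mem measurableSet_Ioi] with s hs
    have hs : 0 < s := hs
    rw [Real.norm_of_nonneg (by positivity)]
    have e : (1 + s) ^ (b - 2) = (1 + s) ^ b * ((1 + s) ^ 2)⁻¹ := by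
      rw [← Real.rpow_natCast, ← Real.rpow_neg (by positivity), ← Real.rpow_add (by positivity)]
      norm_num [sub_eq_add_neg]
    rw [e, ← mul_assoc]
    gcongr
    rw [div_le_iff₀ hp0]
    exact hp s hs.le
  · filter_upwards [ae_restrict_mem measurableSet_Ioi] with s hs
    refine Tendsto.mul_const _ ((hF s hs).congr fun x => ?_)
    rw [mul_comm]

/-! ### Uniqueness of measures on [0, 1]. -/

/-- The kernel of the Stieltjes transform in the variable `u = 1 / (1 + r)`, up to `1 + r`. -/
noncomputable def stieltjesKernel (c : ℝ) (u : unitInterval) : ℝ := (1 - u + c * u)⁻¹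

theorem stieltjesKernel_denom_pos {c : ℝ} (hc : 0 < c) (u : unitInterval) :
    0 < 1 - (u : ℝ) + c * u := by
  have h0 := u.2.1
  have h1 := u.2.2
  rcases h0.eq_or_lt with h | h
  · rw [← h]; norm_num
  · have := mul_pos hc h
    linarith

theorem continuous_stieltjesKernel {c : ℝ} (hc : 0 < c) : Continuous (stieltjesKernel c) := by
  unfold stieltjesKernel
  exact Continuous.inv₀ (by fun_prop) fun u => (stieltjesKernel_denom_pos hc u).ne'

theorem integrable_of_continuous_unitInterval {τ : Measure unitInterval} [IsFiniteMeasure τ]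
    {f : unitInterval → ℝ} (hf : Continuous f) : Integrable f τ :=
  hf.integrable_of_hasCompactSupport (HasCompactSupport.of_compactSpace f)

/-- A finite measure on `[0, 1]` is determined by its moments. -/
theorem Measure.ext_of_moments {τ τ' : Measure unitInterval} [IsFiniteMeasure τ]
    [IsFiniteMeasure τ']
    (h : ∀ n : ℕ, ∫ u, (u : ℝ) ^ n ∂τ = ∫ u, (u : ℝ) ^ n ∂τ') : τ = τ' := by
  have hint : ∀ (ρ : Measure unitInterval) [IsFiniteMeasure ρ] (f : C(unitInterval, ℝ)),
      Integrable f ρ := fun ρ _ f => integrable_of_continuous_unitInterval f.continuous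
  have hpoly : ∀ q : Polynomial ℝ, ∫ u : unitInterval, q.eval (u : ℝ) ∂τ
      = ∫ u : unitInterval, q.eval (u : ℝ) ∂τ' := by
    intro q
    simp_rw [Polynomial.eval_eq_sum_range]
    rw [integral_finsetSum _ fun i _ => integrable_of_continuous_unitInterval (by fun_prop),
      integral_finsetSum _ fun i _ => integrable_of_continuous_unitInterval (by fun_prop)]
    simp_rw [integral_const_mul, h]
  have hall : ∀ f : C(unitInterval, ℝ), ∫ u, f u ∂τ = ∫ u, f u ∂τ' := by
    intro f
    -- Weierstrass: the functions on which both integrals agree form a closed set containing the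
    -- polynomials.
    have hclosed : IsClosed {f : C(unitInterval, ℝ) | ∫ u, f u ∂τ = ∫ u, f u ∂τ'} := by
      have hc : ∀ (ρ : Measure unitInterval) [IsFiniteMeasure ρ],
          Continuous fun f : C(unitInterval, ℝ) => ∫ u, f u ∂ρ := by
        intro ρ _
        have : (fun f : C(unitInterval, ℝ) => ∫ u, f u ∂ρ)
            = fun f => ∫ u, (ContinuousMap.toLp (E := ℝ) 1 ρ ℝ f) u ∂ρ := by
          ext f
          exact integral_congr_ae (ContinuousMap.coeFn_toLp ρ f).symm
        rw [this]
        exact continuous_integral.comp (ContinuousMap.toLp (E := ℝ) 1 ρ ℝ).continuous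
      exact isClosed_eq (hc τ) (hc τ')
    have hmem : f ∈ closure (polynomialFunctions (Set.Icc (0 : ℝ) 1) : Set C(unitInterval, ℝ)) := by
      have := polynomialFunctions.topologicalClosure (Set.Icc (0 : ℝ) 1)
      have hf : f ∈ (polynomialFunctions (Set.Icc (0 : ℝ) 1)).topologicalClosure := by
        rw [this]; trivial
      exact hf
    refine closure_minimal ?_ hclosed hmem
    rintro _ ⟨q, -, rfl⟩
    exact hpoly q
  refine ext_of_forall_integral_eq_of_IsFiniteMeasure fun f => ?_
  exact hall f.toContinuousMap

/-- A finite measure on `[0, 1]` is determined by the integrals of the Stieltjes kernels. -/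
theorem Measure.ext_of_stieltjesKernel {τ τ' : Measure unitInterval} [IsFiniteMeasure τ]
    [IsFiniteMeasure τ']
    (h : ∀ c : ℝ, 0 < c → ∫ u, stieltjesKernel c u ∂τ = ∫ u, stieltjesKernel c u ∂τ') :
    τ = τ' := by
  refine Measure.ext_of_moments fun n => ?_
  have hk : ∀ (z : ℝ) (u : unitInterval), 0 < z → 0 < 1 + z * (u : ℝ) := fun z u hz => by
    have := u.2.1; positivity
  have hlim : ∀ (n : ℕ) (ρ : Measure unitInterval) [IsFiniteMeasure ρ],
      Tendsto (fun z : ℝ => ∫ u : unitInterval, (u : ℝ) ^ n * (1 + z * u)⁻¹ ∂ρ) (𝓝[>] 0)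
        (𝓝 (∫ u : unitInterval, (u : ℝ) ^ n ∂ρ)) := by
    intro n ρ _
    refine tendsto_integral_filter_of_dominated_convergence (fun _ => 1) ?_ ?_
      (integrable_const _) ?_
    · exact Eventually.of_forall fun z => by fun_prop
    · filter_upwards [self_mem_nhdsWithin] with z hz
      refine ae_of_all _ fun u => ?_
      have h0 := u.2.1
      have h1 : (u : ℝ) ≤ 1 := u.2.2
      have hz : 0 < z := hz
      have := hk z u hz
      rw [Real.norm_of_nonneg (by positivity)]
      exact mul_le_one₀ (pow_le_one₀ h0 h1) (by positivity)
        (inv_le_one_of_one_le₀ (le_add_of_nonneg_right (by positivity)))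
    · refine ae_of_all _ fun u => ?_
      have : ContinuousAt (fun z : ℝ => (u : ℝ) ^ n * (1 + z * u)⁻¹) 0 := by
        refine ContinuousAt.mul continuousAt_const (ContinuousAt.inv₀ (by fun_prop) (by simp))
      have := this.tendsto
      simp only [zero_mul, add_zero, inv_one, mul_one] at this
      exact this.mono_left nhdsWithin_le_nhds
  -- With c = 1 + z the kernel is 1/(1 + zu). Subtracting the first n terms of its geometric series
  -- and dividing by (-z)^n leaves u^n/(1 + zu), whose integral tends to the n-th moment as z → 0+.
  -- The subtracted moments agree by induction.
  induction n using Nat.strong_induction_on with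
  | _ n ih =>
    refine tendsto_nhds_unique (hlim n τ) ((hlim n τ').congr' ?_)
    filter_upwards [self_mem_nhdsWithin] with z hz
    have hz : 0 < z := hz
    have expand : ∀ u : unitInterval, (u : ℝ) ^ n * (1 + z * u)⁻¹
        = ((-z) ^ n)⁻¹ * (stieltjesKernel (1 + z) u - ∑ j ∈ Finset.range n, (-z) ^ j * (u : ℝ) ^ j) := by
      intro u
      have h1 := hk z u hz
      have e : 1 - (u : ℝ) + (1 + z) * u = 1 + z * u := by ring
      have hz' : (-z) ^ n ≠ 0 := pow_ne_zero _ (neg_ne_zero.2 hz.ne')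
      have hg := mul_neg_geom_sum (-z * (u : ℝ)) n
      simp only [mul_pow] at hg
      rw [stieltjesKernel, e]
      field_simp
      have : (1 + z * (u : ℝ)) * ∑ j ∈ Finset.range n, (-z) ^ j * (u : ℝ) ^ j
          = 1 - (-z) ^ n * (u : ℝ) ^ n := by
        rw [← hg]; ring
      rw [this]; ring
    have hval : ∀ (ρ : Measure unitInterval) [IsFiniteMeasure ρ],
        ∫ u : unitInterval, (u : ℝ) ^ n * (1 + z * u)⁻¹ ∂ρ
        = ((-z) ^ n)⁻¹ * (∫ u, stieltjesKernel (1 + z) u ∂ρ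
          - ∑ j ∈ Finset.range n, (-z) ^ j * ∫ u : unitInterval, (u : ℝ) ^ j ∂ρ) := by
      intro ρ _
      simp_rw [expand]
      rw [integral_const_mul, integral_sub
        (integrable_of_continuous_unitInterval (continuous_stieltjesKernel (by positivity)))
        (integrable_of_continuous_unitInterval (by fun_prop)),
        integral_finsetSum _ fun i _ => integrable_of_continuous_unitInterval (by fun_prop)]
      simp_rw [integral_const_mul]
    rw [hval τ', hval τ, h (1 + z) (by positivity)]
    congr 2
    refine Finset.sum_congr rfl fun j hj => ?_
    rw [ih j (Finset.mem_range.1 hj)]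

/-! ### Rescaled probability measures on [0, 1]. -/

/-- The measure `μ` rescaled by `x`, normalised and transported to `[0, 1]` by
`r ↦ x / (x + r)`. -/
noncomputable def rescaledMeasure (μ : Measure ℝ) (x : ℝ) : Measure unitInterval :=
  (μ.withDensity fun r => ENNReal.ofReal ((x + r)⁻¹ / stieltjesTransform μ x)).map
    fun r => Set.projIcc (0 : ℝ) 1 zero_le_one (x / (x + r))

theorem measurable_projIcc_div_add (x : ℝ) :
    Measurable fun r : ℝ => Set.projIcc (0 : ℝ) 1 zero_le_one (x / (x + r)) :=
  continuous_projIcc.measurable.comp (by fun_prop)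

theorem coe_projIcc_div_add {x r : ℝ} (hx : 0 < x) (hr : 0 ≤ r) :
    (Set.projIcc (0 : ℝ) 1 zero_le_one (x / (x + r)) : ℝ) = x / (x + r) := by
  rw [Set.projIcc_of_mem zero_le_one
    ⟨by positivity, (div_le_one (by positivity)).2 (by linarith)⟩]

namespace StieltjesIntegrable

variable {μ : Measure ℝ}

theorem integral_rescaledMeasure (h : StieltjesIntegrable μ) {x : ℝ} (hx : 0 < x)
    {g : unitInterval → ℝ} (hg : Measurable g) :
    ∫ u, g u ∂(rescaledMeasure μ x)
      = (∫ r, (x + r)⁻¹ * g (Set.projIcc (0 : ℝ) 1 zero_le_one (x / (x + r))) ∂μ)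
        / stieltjesTransform μ x := by
  unfold rescaledMeasure
  rw [integral_map (measurable_projIcc_div_add x).aemeasurable hg.aestronglyMeasurable,
    integral_withDensity_eq_integral_toReal_smul (by fun_prop)
    (ae_of_all _ fun _ => ENNReal.ofReal_lt_top), ← integral_div]
  refine integral_congr_ae ?_
  filter_upwards [h.ae_nonneg] with r hr
  have h1 := h.stieltjesTransform_nonneg hx
  rw [ENNReal.toReal_ofReal (by positivity), smul_eq_mul]
  ring

theorem isProbabilityMeasure_rescaledMeasure (h : StieltjesIntegrable μ) (hμ : μ ≠ 0) {x : ℝ}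
    (hx : 0 < x) : IsProbabilityMeasure (rescaledMeasure μ x) := by
  unfold rescaledMeasure
  refine ⟨?_⟩
  rw [Measure.map_apply (measurable_projIcc_div_add x) MeasurableSet.univ, Set.preimage_univ,
    withDensity_apply _ MeasurableSet.univ, Measure.restrict_univ,
    ← ofReal_integral_eq_lintegral_ofReal ((h.integrable_inv_add hx).div_const _)]
  · rw [integral_div]
    change ENNReal.ofReal (stieltjesTransform μ x / _) = 1
    rw [div_self (h.stieltjesTransform_pos hμ hx).ne', ENNReal.ofReal_one]
  · filter_upwards [h.ae_nonneg] with r hr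
    have h1 := h.stieltjesTransform_nonneg hx
    simp only [Pi.zero_apply]; positivity

theorem integral_stieltjesKernel_rescaledMeasure (h : StieltjesIntegrable μ) {x c : ℝ}
    (hx : 0 < x) (hc : 0 < c) :
    ∫ u, stieltjesKernel c u ∂(rescaledMeasure μ x)
      = stieltjesTransform μ (c * x) / stieltjesTransform μ x := by
  rw [h.integral_rescaledMeasure hx (continuous_stieltjesKernel hc).measurable]
  congr 1
  refine integral_congr_ae ?_
  filter_upwards [h.ae_nonneg] with r hr
  simp only [stieltjesKernel]
  rw [coe_projIcc_div_add hx hr]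
  have h1 : 0 < c * x + r := by positivity
  have e : 1 - x / (x + r) + c * (x / (x + r)) = (c * x + r) / (x + r) := by
    field_simp; ring
  rw [e, inv_div]
  field_simp

/-- The function on `[0, 1]` whose integrals against the rescaled measures give the
distribution function. -/
noncomputable def _root_.cutoffInv (u : unitInterval) : ℝ :=
  -- The `max` changes nothing on the set u ≥ 1/2; it keeps the factor continuous and bounded by 2
  -- everywhere.
  Set.indicator {u : unitInterval | 1 / 2 ≤ (u : ℝ)} (fun u => (max (u : ℝ) (1 / 2))⁻¹) u

theorem _root_.measurable_cutoffInv : Measurable cutoffInv := by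
  unfold cutoffInv
  exact Measurable.indicator (by fun_prop) (measurableSet_le (by fun_prop) (by fun_prop))

theorem integral_cutoffInv_rescaledMeasure (h : StieltjesIntegrable μ) {x : ℝ} (hx : 0 < x) :
    ∫ u, cutoffInv u ∂(rescaledMeasure μ x)
      = μ.real (Set.Icc 0 x) / (x * stieltjesTransform μ x) := by
  rw [h.integral_rescaledMeasure hx measurable_cutoffInv, ← div_div]
  congr 1
  -- For u = x/(x + r), u ≥ 1/2 means r ≤ x, and (x + r)⁻¹ u⁻¹ = x⁻¹ is constant there.
  have e : ∀ᵐ r ∂μ, (x + r)⁻¹ * cutoffInv (Set.projIcc (0 : ℝ) 1 zero_le_one (x / (x + r)))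
      = Set.indicator (Set.Icc 0 x) (fun _ => x⁻¹) r := by
    filter_upwards [h.ae_nonneg] with r hr
    have h1 : 0 < x + r := by positivity
    simp only [cutoffInv, Set.indicator, Set.mem_ofPred_eq]
    rw [coe_projIcc_div_add hx hr]
    by_cases hrx : r ≤ x
    · have h2 : 1 / 2 ≤ x / (x + r) := by
        rw [div_le_div_iff₀ two_pos h1]; linarith
      rw [if_pos h2, if_pos ⟨hr, hrx⟩, max_eq_left h2]
      field_simp
    · have h2 : ¬ 1 / 2 ≤ x / (x + r) := by
        rw [div_le_div_iff₀ two_pos h1]; linarith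
      rw [if_neg h2, if_neg (fun hh => hrx hh.2), mul_zero]
  rw [integral_congr_ae e, integral_indicator measurableSet_Icc]
  simp [div_eq_mul_inv]

end StieltjesIntegrable

/-! ### Weak convergence against a discontinuous test function. -/

/-- Portmanteau argument: a test function squeezed between continuous ones with nearly equal
P₀-integrals inherits their convergence. -/
theorem tendsto_integral_of_sandwich {ι : Type*} {l : Filter ι}
    {P : ι → ProbabilityMeasure unitInterval} {P₀ : ProbabilityMeasure unitInterval}
    (hP : Tendsto P l (𝓝 P₀)) {g : unitInterval → ℝ} (hg : Measurable g)
    (H : ∀ δ > 0, ∃ f₁ f₂ : C(unitInterval, ℝ), (∀ u, f₁ u ≤ g u) ∧ (∀ u, g u ≤ f₂ u) ∧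
      ∫ u, f₂ u ∂(P₀ : Measure unitInterval) < ∫ u, f₁ u ∂(P₀ : Measure unitInterval) + δ) :
    Tendsto (fun i => ∫ u, g u ∂(P i : Measure unitInterval)) l
      (𝓝 (∫ u, g u ∂(P₀ : Measure unitInterval))) := by
  have hint : ∀ (P : ProbabilityMeasure unitInterval) (f : C(unitInterval, ℝ)),
      Integrable f (P : Measure unitInterval) := fun P f =>
    integrable_of_continuous_unitInterval f.continuous
  obtain ⟨a, b, ha, hb, -⟩ := H 1 one_pos
  have hgint : ∀ (P : ProbabilityMeasure unitInterval), Integrable g (P : Measure unitInterval) := by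
    intro P
    refine ((hint P a).abs.add (hint P b).abs).mono' hg.aestronglyMeasurable
      (ae_of_all _ fun u => ?_)
    rw [Real.norm_eq_abs, abs_le]
    have h1 := ha u
    have h2 := hb u
    have h3 := neg_abs_le (a u)
    have h4 := le_abs_self (b u)
    have h5 := abs_nonneg (a u)
    have h6 := abs_nonneg (b u)
    simp only [Pi.add_apply]
    constructor <;> linarith
  have hconv : ∀ f : C(unitInterval, ℝ), Tendsto (fun i => ∫ u, f u ∂(P i : Measure unitInterval)) l
      (𝓝 (∫ u, f u ∂(P₀ : Measure unitInterval))) := fun f =>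
    (ProbabilityMeasure.tendsto_iff_forall_integral_tendsto.1 hP) (BoundedContinuousFunction.mkOfCompact f)
  rw [tendsto_order]
  constructor
  · intro y hy
    obtain ⟨f₁, f₂, h1, h2, h3⟩ := H _ (sub_pos.2 hy)
    have h4 : ∫ u, g u ∂(P₀ : Measure unitInterval) ≤ ∫ u, f₂ u ∂(P₀ : Measure unitInterval) :=
      integral_mono (hgint _) (hint _ _) h2
    filter_upwards [(hconv f₁).eventually_const_lt (u := y) (by linarith)] with i hi
    exact hi.trans_le (integral_mono (hint _ _) (hgint _) h1)
  · intro y hy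
    obtain ⟨f₁, f₂, h1, h2, h3⟩ := H _ (sub_pos.2 hy)
    have h4 : ∫ u, f₁ u ∂(P₀ : Measure unitInterval) ≤ ∫ u, g u ∂(P₀ : Measure unitInterval) :=
      integral_mono (hint _ _) (hgint _) h1
    filter_upwards [(hconv f₂).eventually_lt_const (u := y) (by linarith)] with i hi
    exact (integral_mono (hgint _) (hint _ _) h2).trans_lt hi

/-- Continuous approximations of `cutoffInv`. -/
noncomputable def cutoffInvApprox (n : ℕ) (d : ℝ) : C(unitInterval, ℝ) where
  toFun u := (max (u : ℝ) (1 / 2))⁻¹ * max 0 (min 1 (n * ((u : ℝ) - 1 / 2) + d))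
  continuous_toFun := by
    refine Continuous.mul (Continuous.inv₀ (by fun_prop) fun u => ?_) (by fun_prop)
    positivity

theorem tendsto_integral_cutoffInv {ι : Type*} {l : Filter ι}
    {P : ι → ProbabilityMeasure unitInterval} {P₀ : ProbabilityMeasure unitInterval}
    (hP : Tendsto P l (𝓝 P₀))
    (h0 : (P₀ : Measure unitInterval) {u : unitInterval | (u : ℝ) = 1 / 2} = 0) :
    Tendsto (fun i => ∫ u, cutoffInv u ∂(P i : Measure unitInterval)) l
      (𝓝 (∫ u, cutoffInv u ∂(P₀ : Measure unitInterval))) := by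
  refine tendsto_integral_of_sandwich hP measurable_cutoffInv fun δ hδ => ?_
  have hbound : ∀ u : unitInterval, (max (u : ℝ) (1 / 2))⁻¹ ≤ 2 := fun u => by
    rw [inv_le_comm₀ (by positivity) two_pos, ← one_div]; exact le_max_right _ _
  have hlim : ∀ d : ℝ, Tendsto (fun n => ∫ u, cutoffInvApprox n d u ∂(P₀ : Measure unitInterval)) atTop
      (𝓝 (∫ u, cutoffInv u ∂(P₀ : Measure unitInterval))) := by
    intro d
    refine tendsto_integral_of_dominated_convergence (fun _ => 2) (fun n => by fun_prop)
      (integrable_const _) (fun n => ae_of_all _ fun u => ?_) ?_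
    · simp only [cutoffInvApprox, ContinuousMap.coe_mk]
      rw [Real.norm_of_nonneg (by positivity)]
      calc _ ≤ (2 : ℝ) * 1 := mul_le_mul (hbound u)
            (max_le zero_le_one (min_le_left _ _)) (by positivity) two_pos.le
        _ = 2 := mul_one 2
    · have : ∀ᵐ u : unitInterval ∂(P₀ : Measure unitInterval), (u : ℝ) ≠ 1 / 2 := by
        rw [ae_iff]; simpa using h0
      filter_upwards [this] with u hu
      refine tendsto_const_nhds.congr' ?_
      simp only [cutoffInvApprox, ContinuousMap.coe_mk, cutoffInv, Set.indicator,
        Set.mem_ofPred_eq]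
      rcases lt_or_gt_of_ne hu with hu | hu
      · have := (tendsto_natCast_atTop_atTop (R := ℝ)).atTop_mul_const_of_neg (sub_neg.2 hu)
        filter_upwards [(tendsto_atBot_add_const_right _ d this).eventually_le_atBot 0] with n hn
        rw [if_neg (not_le.2 hu), max_eq_left ((min_le_right _ _).trans hn), mul_zero]
      · have := (tendsto_natCast_atTop_atTop (R := ℝ)).atTop_mul_const (sub_pos.2 hu)
        filter_upwards [(tendsto_atTop_add_const_right _ d this).eventually_ge_atTop 1] with n hn
        rw [if_pos hu.le, min_eq_left hn, max_eq_right zero_le_one, mul_one]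
  have := ((hlim 1).sub (hlim 0)).eventually_lt_const (u := δ) (by simpa using hδ)
  obtain ⟨n, hn⟩ := this.exists
  -- The shift d places the ramp of slope n: for d = 0 it starts rising at 1/2 and stays below the
  -- jump, for d = 1 it is complete at 1/2 and stays above it.
  refine ⟨cutoffInvApprox n 0, cutoffInvApprox n 1, fun u => ?_, fun u => ?_, by linarith⟩
  · simp only [cutoffInvApprox, ContinuousMap.coe_mk, cutoffInv, Set.indicator,
        Set.mem_ofPred_eq]
    split_ifs with hu
    · exact mul_le_of_le_one_right (by positivity) (max_le zero_le_one (min_le_left _ _))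
    · have : (n : ℝ) * ((u : ℝ) - 1 / 2) ≤ 0 :=
        mul_nonpos_of_nonneg_of_nonpos (by positivity) (by linarith)
      rw [add_zero, max_eq_left ((min_le_right _ _).trans this), mul_zero]
  · simp only [cutoffInvApprox, ContinuousMap.coe_mk, cutoffInv, Set.indicator,
        Set.mem_ofPred_eq]
    split_ifs with hu
    · have : 0 ≤ (n : ℝ) * ((u : ℝ) - 1 / 2) := mul_nonneg (by positivity) (by linarith)
      rw [min_eq_left (by linarith), max_eq_right zero_le_one, mul_one]
    · positivity

/-! ### The Tauberian theorem. -/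

/-- Karamata's Tauberian theorem for the Stieltjes transform. -/
theorem StieltjesIntegrable.tendsto_measureReal_div {ν : Measure ℝ}
    (h : StieltjesIntegrable ν) (hν : ν ≠ 0) {a : ℝ} (h0 : 0 < a) (h1 : a < 1)
    (hT : RegularlyVarying (stieltjesTransform ν) (a - 1)) :
    Tendsto (fun x => ν.real (Set.Icc 0 x) / (x * stieltjesTransform ν x)) atTop
      (𝓝 (Viscoelastic.cst a)⁻¹) := by
  have hpow := stieltjesIntegrable_powerMeasure h0 h1
  have hpow0 : powerMeasure a ≠ 0 := by
    intro h'
    have := stieltjesTransform_powerMeasure h0 h1 one_pos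
    simp [h', stieltjesTransform] at this
  -- The `max` only makes the family defined for every real x; it disappears for x ≥ 1.
  let P : ℝ → ProbabilityMeasure unitInterval := fun x =>
    ⟨rescaledMeasure ν (max x 1), h.isProbabilityMeasure_rescaledMeasure hν (by positivity)⟩
  let P₀ : ProbabilityMeasure unitInterval :=
    ⟨rescaledMeasure (powerMeasure a) 1, hpow.isProbabilityMeasure_rescaledMeasure hpow0 one_pos⟩
  have hP : Tendsto P atTop (𝓝 P₀) := by
    rw [tendsto_iff_ultrafilter]
    -- By compactness every ultrafilter along x → ∞ has a limit point P'. Regular variation makes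
    -- its kernel integrals equal to c^(a-1), those of the model, so P' = P₀ by uniqueness.
    intro U hU
    obtain ⟨P', hP'⟩ : ∃ P' : ProbabilityMeasure unitInterval, ((U.map P : Ultrafilter _) : Filter _) ≤ 𝓝 P' := by
      obtain ⟨P', -, hP'⟩ := isCompact_univ.ultrafilter_le_nhds (U.map P) (by simp)
      exact ⟨P', hP'⟩
    have hPU : Tendsto P U (𝓝 P') := hP'
    suffices P' = P₀ by rwa [← this]
    refine Subtype.ext (Measure.ext_of_stieltjesKernel (τ := (P' : Measure unitInterval))
      (τ' := (P₀ : Measure unitInterval)) fun c hc => ?_)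
    have e0 : ∫ u, stieltjesKernel c u ∂(P₀ : Measure unitInterval) = c ^ (a - 1) := by
      change ∫ u, stieltjesKernel c u ∂(rescaledMeasure (powerMeasure a) 1) = _
      rw [hpow.integral_stieltjesKernel_rescaledMeasure one_pos hc, mul_one,
        stieltjesTransform_powerMeasure h0 h1 hc, stieltjesTransform_powerMeasure h0 h1 one_pos]
      simp
    have hl1 : Tendsto (fun i => ∫ u, stieltjesKernel c u ∂(P i : Measure unitInterval)) U
        (𝓝 (∫ u, stieltjesKernel c u ∂(P' : Measure unitInterval))) :=
      (ProbabilityMeasure.tendsto_iff_forall_integral_tendsto.1 hPU)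
        (BoundedContinuousFunction.mkOfCompact ⟨_, continuous_stieltjesKernel hc⟩)
    have hl2 : Tendsto (fun i => ∫ u, stieltjesKernel c u ∂(P i : Measure unitInterval)) U
        (𝓝 (c ^ (a - 1))) := by
      refine ((hT c hc).congr' ?_).mono_left hU
      filter_upwards [eventually_ge_atTop 1] with x hx
      change _ = ∫ u, stieltjesKernel c u ∂(rescaledMeasure ν (max x 1))
      rw [max_eq_left hx,
        h.integral_stieltjesKernel_rescaledMeasure (one_pos.trans_le hx) hc]
    exact (tendsto_nhds_unique hl1 hl2).trans e0.symm
  -- At scale 1 the point u = 1/2 corresponds to r = 1, which the absolutely continuous model does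
  -- not charge.
  have hnull : (P₀ : Measure unitInterval) {u : unitInterval | (u : ℝ) = 1 / 2} = 0 := by
    change rescaledMeasure (powerMeasure a) 1 _ = 0
    have hms : MeasurableSet {u : unitInterval | (u : ℝ) = 1 / 2} :=
      measurableSet_eq_fun (by fun_prop) (by fun_prop)
    unfold rescaledMeasure
    rw [Measure.map_apply (measurable_projIcc_div_add 1) hms]
    refine withDensity_absolutelyContinuous _ _ ?_
    unfold powerMeasure
    refine withDensity_absolutelyContinuous _ _ ?_
    refine measure_mono_null (t := Set.Iio 0 ∪ {1}) ?_ ?_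
    · intro r hr
      by_cases hr0 : r < 0
      · exact Or.inl hr0
      · right
        rw [Set.mem_preimage, Set.mem_ofPred_eq, coe_projIcc_div_add one_pos (not_lt.1 hr0)] at hr
        have : 0 < 1 + r := by linarith
        field_simp at hr
        simp only [Set.mem_singleton_iff]
        linarith
    · rw [measure_union_null_iff]
      constructor
      · rw [Measure.restrict_apply measurableSet_Iio]
        have : Set.Iio (0 : ℝ) ∩ Set.Ioi 0 = ∅ := by
          ext x; simp only [Set.mem_inter_iff, Set.mem_Iio, Set.mem_Ioi, Set.mem_empty_iff_false]
          constructor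
          · rintro ⟨h, h'⟩; exact lt_asymm h h'
          · simp
        rw [this]; simp
      · exact measure_singleton 1
  have key := tendsto_integral_cutoffInv hP hnull
  have e0 : ∫ u, cutoffInv u ∂(P₀ : Measure unitInterval) = (Viscoelastic.cst a)⁻¹ := by
    change ∫ u, cutoffInv u ∂(rescaledMeasure (powerMeasure a) 1) = _
    rw [hpow.integral_cutoffInv_rescaledMeasure one_pos,
      measureReal_Icc_powerMeasure h0 h1 zero_le_one, stieltjesTransform_powerMeasure h0 h1 one_pos]
    simp
  rw [e0] at key
  refine key.congr' ?_
  filter_upwards [eventually_ge_atTop 1] with x hx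
  change ∫ u, cutoffInv u ∂(rescaledMeasure ν (max x 1)) = _
  rw [max_eq_left hx, h.integral_cutoffInv_rescaledMeasure (one_pos.trans_le hx)]

/-! ### Closure properties of Stieltjes means. -/

/-- Functions `c ↦ ∫ dτ(u) / (1 - u + c u)` with a probability measure `τ` on `[0, 1]`. -/
def IsStieltjesMean (f : ℝ → ℝ) : Prop :=
  ∃ τ : ProbabilityMeasure unitInterval, ∀ c : ℝ, 0 < c →
    f c = ∫ u, stieltjesKernel c u ∂(τ : Measure unitInterval)

/-- Probability measures on [0, 1] are weakly compact: a limit of representing measures along an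
ultrafilter represents the limit function, each kernel being continuous. -/
theorem IsStieltjesMean.of_tendsto {f : ℝ → ℝ} {F : ℕ → ℝ → ℝ} (hF : ∀ n, IsStieltjesMean (F n))
    (hlim : ∀ c : ℝ, 0 < c → Tendsto (fun n => F n c) atTop (𝓝 (f c))) : IsStieltjesMean f := by
  choose P hP using hF
  obtain ⟨τ, -, hτ⟩ := isCompact_univ.ultrafilter_le_nhds ((hyperfilter ℕ).map P) (by simp)
  have hτ : Tendsto P (hyperfilter ℕ) (𝓝 τ) := hτ
  refine ⟨τ, fun c hc => ?_⟩
  have h1 : Tendsto (fun n => ∫ u, stieltjesKernel c u ∂(P n : Measure unitInterval))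
      (hyperfilter ℕ) (𝓝 (∫ u, stieltjesKernel c u ∂(τ : Measure unitInterval))) :=
    (ProbabilityMeasure.tendsto_iff_forall_integral_tendsto.1 hτ)
      (BoundedContinuousFunction.mkOfCompact ⟨_, continuous_stieltjesKernel hc⟩)
  have h2 : Tendsto (fun n => F n c) (hyperfilter ℕ) (𝓝 (f c)) :=
    (hlim c hc).mono_left (by rw [← Nat.cofinite_eq_atTop]; exact hyperfilter_le_cofinite)
  simp_rw [hP _ c hc] at h2
  exact tendsto_nhds_unique h2 h1

theorem integral_sum_smul_measure {α ι : Type*} [MeasurableSpace α] (s : Finset ι) {w : ι → ℝ}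
    (hw : ∀ i ∈ s, 0 ≤ w i) (P : ι → Measure α) {f : α → ℝ} (hf : ∀ i ∈ s, Integrable f (P i)) :
    ∫ x, f x ∂(∑ i ∈ s, ENNReal.ofReal (w i) • P i) = ∑ i ∈ s, w i * ∫ x, f x ∂(P i) := by
  rw [integral_finsetSum_measure fun i hi => (hf i hi).smul_measure ENNReal.ofReal_ne_top]
  refine Finset.sum_congr rfl fun i hi => ?_
  rw [integral_smul_measure, ENNReal.toReal_ofReal (hw i hi), smul_eq_mul]

theorem isProbabilityMeasure_sum_smul {α ι : Type*} [MeasurableSpace α] (s : Finset ι) {w : ι → ℝ}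
    (hw : ∀ i ∈ s, 0 ≤ w i) (hw1 : ∑ i ∈ s, w i = 1) (P : ι → Measure α)
    [∀ i, IsProbabilityMeasure (P i)] :
    IsProbabilityMeasure (∑ i ∈ s, ENNReal.ofReal (w i) • P i) := by
  refine ⟨?_⟩
  simp only [Measure.coe_finsetSum, Finset.sum_apply, Measure.smul_apply, measure_univ,
    smul_eq_mul, mul_one]
  rw [← ENNReal.ofReal_sum_of_nonneg hw, hw1, ENNReal.ofReal_one]

theorem IsStieltjesMean.sum {ι : Type*} (s : Finset ι) {w : ι → ℝ} (hw : ∀ i ∈ s, 0 ≤ w i)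
    (hw1 : ∑ i ∈ s, w i = 1) {F : ι → ℝ → ℝ} (hF : ∀ i, IsStieltjesMean (F i)) :
    IsStieltjesMean fun c => ∑ i ∈ s, w i * F i c := by
  choose P hP using hF
  refine ⟨⟨_, isProbabilityMeasure_sum_smul s hw hw1 fun i => (P i : Measure unitInterval)⟩,
    fun c hc => ?_⟩
  change _ = ∫ u, _ ∂(∑ i ∈ s, ENNReal.ofReal (w i) • (P i : Measure unitInterval))
  rw [integral_sum_smul_measure s hw _ fun i _ =>
    integrable_of_continuous_unitInterval (continuous_stieltjesKernel hc)]
  exact Finset.sum_congr rfl fun i _ => by rw [hP i c hc]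

/-- Weak approximation of a probability measure by finitely supported ones. -/
theorem exists_finite_approximation (P : Measure unitInterval) [IsProbabilityMeasure P] :
    ∃ (S : ℕ → Finset unitInterval) (w : ℕ → unitInterval → ℝ),
      (∀ n y, 0 ≤ w n y) ∧ (∀ n, ∑ y ∈ S n, w n y = 1) ∧
      ∀ g : unitInterval → ℝ, Continuous g →
        Tendsto (fun n => ∑ y ∈ S n, w n y * g y) atTop (𝓝 (∫ u, g u ∂P)) := by
  -- Simple functions converging to the identity push P forward to finitely supported measures.
  have hid : StronglyMeasurable (id : unitInterval → unitInterval) := stronglyMeasurable_id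
  let s := hid.approx
  have hsum : ∀ n (g : unitInterval → ℝ),
      ∑ y ∈ (s n).range, P.real (s n ⁻¹' {y}) * g y = ∫ u, g (s n u) ∂P := by
    intro n g
    have e : ∀ u, g (s n u) = ∑ y ∈ (s n).range, Set.indicator (s n ⁻¹' {y}) (fun _ => g y) u := by
      intro u
      rw [Finset.sum_eq_single (s n u)]
      · simp
      · intro y _ hy
        exact Set.indicator_of_notMem (fun h => hy (by simpa using h.symm)) _
      · intro h; exact absurd ((s n).mem_range_self u) h
    simp_rw [e]
    rw [integral_finsetSum _ fun y _ =>
      (integrable_const _).indicator ((s n).measurableSet_fiber y)]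
    refine Finset.sum_congr rfl fun y _ => ?_
    rw [integral_indicator_const _ ((s n).measurableSet_fiber y), smul_eq_mul]
  refine ⟨fun n => (s n).range, fun n y => P.real (s n ⁻¹' {y}), fun n y => measureReal_nonneg,
    fun n => ?_, fun g hg => ?_⟩
  · simpa using hsum n fun _ => 1
  · simp_rw [hsum]
    obtain ⟨C, hC⟩ := isCompact_univ.exists_bound_of_continuousOn (f := g) hg.continuousOn
    refine tendsto_integral_of_dominated_convergence (fun _ => C)
      (fun n => (hg.measurable.comp (s n).measurable).aestronglyMeasurable) (integrable_const _)
      (fun n => ae_of_all _ fun u => hC _ (Set.mem_univ _)) (ae_of_all _ fun u => ?_)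
    exact (hg.tendsto u).comp (hid.tendsto_approx u)

theorem IsStieltjesMean.integral (P : Measure unitInterval) [IsProbabilityMeasure P]
    {F : unitInterval → ℝ → ℝ} (hF : ∀ t, IsStieltjesMean (F t))
    (hcont : ∀ c : ℝ, 0 < c → Continuous fun t => F t c) :
    IsStieltjesMean fun c => ∫ t, F t c ∂P := by
  obtain ⟨S, w, hw, hw1, hlim⟩ := exists_finite_approximation P
  exact IsStieltjesMean.of_tendsto
    (fun n => IsStieltjesMean.sum (S n) (fun y _ => hw n y) (hw1 n) hF)
    fun c hc => hlim _ (hcont c hc)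

/-! ### Resolvents, reciprocals and powers. -/

/-- Matrix elements of the resolvent of a symmetric matrix with spectrum in `[0, 1]`. -/
theorem exists_probabilityMeasure_resolvent {n : Type*} [Fintype n] [DecidableEq n]
    {Y : Matrix n n ℝ} (hY : Y.IsHermitian) (h0 : ∀ x : n → ℝ, 0 ≤ x ⬝ᵥ (Y.mulVec x))
    (h1 : ∀ x : n → ℝ, x ⬝ᵥ (Y.mulVec x) ≤ x ⬝ᵥ x) (e : n) :
    ∃ τ : ProbabilityMeasure unitInterval, ∀ c : ℝ, 0 < c → ∀ x : n → ℝ,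
      x + (c - 1) • Y.mulVec x = Pi.single e 1 →
        x e = ∫ u, stieltjesKernel c u ∂(τ : Measure unitInterval) := by
  let v : n → n → ℝ := fun j => hY.eigenvectorBasis j
  have hinner : ∀ x y : n → ℝ,
      inner ℝ (WithLp.toLp 2 x : EuclideanSpace ℝ n) (WithLp.toLp 2 y) = x ⬝ᵥ y := by
    intro x y
    rw [EuclideanSpace.inner_toLp_toLp, star_trivial, dotProduct_comm]
  have hvv : ∀ j, v j ⬝ᵥ v j = 1 := by
    intro j
    rw [← hinner]
    exact (real_inner_self_eq_norm_sq _).trans (by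
      have := hY.eigenvectorBasis.orthonormal.1 j
      change ‖hY.eigenvectorBasis j‖ ^ 2 = 1
      rw [this, one_pow])
  have hYv : ∀ j, Y.mulVec (v j) = hY.eigenvalues j • v j := fun j => hY.mulVec_eigenvectorBasis j
  have hsum : ∀ x y : n → ℝ, ∑ j, (x ⬝ᵥ v j) * (v j ⬝ᵥ y) = x ⬝ᵥ y := by
    intro x y
    have := hY.eigenvectorBasis.sum_inner_mul_inner (WithLp.toLp 2 x) (WithLp.toLp 2 y)
    rw [hinner] at this
    rw [← this]
    refine Finset.sum_congr rfl fun j _ => ?_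
    rw [← hinner, ← hinner]
  have hlam : ∀ j, hY.eigenvalues j ∈ Set.Icc (0 : ℝ) 1 := by
    intro j
    have a := h0 (v j)
    have b := h1 (v j)
    rw [hYv, dotProduct_smul, hvv, smul_eq_mul, mul_one] at a b
    exact ⟨a, b⟩
  have hw1 : ∑ j, (v j e) ^ 2 = 1 := by
    have := hsum (Pi.single e 1) (Pi.single e 1)
    simp only [single_one_dotProduct, dotProduct_single_one, Pi.single_eq_same] at this
    rw [← this]
    exact Finset.sum_congr rfl fun j _ => sq _
  -- This is the spectral measure of Y at the basis vector e: mass (v_j e)² at the eigenvalue λ_j.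
  refine ⟨⟨_, isProbabilityMeasure_sum_smul Finset.univ (fun j _ => sq_nonneg (v j e)) hw1
    fun j => Measure.dirac (⟨hY.eigenvalues j, hlam j⟩ : unitInterval)⟩, fun c hc x hx => ?_⟩
  change _ = ∫ u, _ ∂(∑ j, ENNReal.ofReal ((v j e) ^ 2) •
    Measure.dirac (⟨hY.eigenvalues j, hlam j⟩ : unitInterval))
  rw [integral_sum_smul_measure _ (fun j _ => sq_nonneg (v j e)) _ fun i _ =>
    integrable_of_continuous_unitInterval (continuous_stieltjesKernel hc)]
  simp_rw [integral_dirac]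
  have hx' : x e = Pi.single e (1 : ℝ) ⬝ᵥ x := by simp
  rw [hx', ← hsum]
  refine Finset.sum_congr rfl fun j _ => ?_
  have hpos := stieltjesKernel_denom_pos hc ⟨hY.eigenvalues j, hlam j⟩
  have hk : v j e = (1 - hY.eigenvalues j + c * hY.eigenvalues j) * (v j ⬝ᵥ x) := by
    have e1 : v j ⬝ᵥ (Pi.single e (1 : ℝ)) = v j e := by simp
    have e2 : v j ⬝ᵥ Y.mulVec x = hY.eigenvalues j * (v j ⬝ᵥ x) := by
      have hT : Y.transpose = Y := by
        have := hY.eq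
        rwa [Matrix.conjTranspose_eq_transpose_of_trivial] at this
      rw [Matrix.dotProduct_mulVec, ← Matrix.mulVec_transpose, hT, hYv, smul_dotProduct,
        smul_eq_mul]
    rw [← e1, ← hx, dotProduct_add, dotProduct_smul, e2, smul_eq_mul]
    ring
  have e3 : Pi.single e (1 : ℝ) ⬝ᵥ v j = v j e := by simp
  rw [e3, stieltjesKernel]
  simp only at hpos ⊢
  have hq : (v j ⬝ᵥ x) = v j e * (1 - hY.eigenvalues j + c * hY.eigenvalues j)⁻¹ := by
    rw [eq_mul_inv_iff_mul_eq₀ hpos.ne', hk]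
    ring
  rw [hq]; ring

/-- The denominator is the Schur complement of the diagonal block in 1 + (c - 1)Y, for an arrow
matrix Y with diagonal block diag(u_i), border b and corner y. Its reciprocal is therefore the
corner entry of the resolvent. -/
theorem isStieltjesMean_inv_of_finite {ι : Type*} [Fintype ι] [DecidableEq ι]
    {m : ι → ℝ} (hm : ∀ i, 0 ≤ m i) (hm1 : ∑ i, m i = 1) (u : ι → unitInterval)
    (t : unitInterval) :
    IsStieltjesMean fun c => (1 - t + t * (c * ∑ i, m i * stieltjesKernel c (u i)))⁻¹ := by
  have hu0 : ∀ i, 0 ≤ (u i : ℝ) := fun i => (u i).2.1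
  have hu1 : ∀ i, 0 ≤ 1 - (u i : ℝ) := fun i => sub_nonneg.2 (u i).2.2
  have ht0 : 0 ≤ (t : ℝ) := t.2.1
  have ht1 : 0 ≤ 1 - (t : ℝ) := sub_nonneg.2 t.2.2
  -- The values of b and y are forced by matching the Schur complement with the given denominator.
  -- They also give 0 ≤ Y ≤ 1: both quadratic forms below complete to sums of squares, with
  -- remainder (1 - t) x₀² in the second.
  let b : ι → ℝ := fun i => √(t * m i * (u i) * (1 - u i))
  have hb : ∀ i, b i ^ 2 = t * m i * u i * (1 - u i) := fun i =>
    Real.sq_sqrt (mul_nonneg (mul_nonneg (mul_nonneg ht0 (hm i)) (hu0 i)) (hu1 i))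
  let y : ℝ := ∑ i, t * m i * (1 - u i)
  let Y : Matrix (Option ι) (Option ι) ℝ := fun p q =>
    p.elim (q.elim y b) fun i => q.elim (b i) fun j => if i = j then (u i : ℝ) else 0
  have hY : Y.IsHermitian := by
    ext p q
    rw [Matrix.conjTranspose_apply, star_trivial]
    rcases p with _ | i <;> rcases q with _ | j
    · rfl
    · rfl
    · rfl
    · simp only [Y, Option.elim]
      by_cases h : i = j
      · subst h; rfl
      · rw [if_neg h, if_neg (Ne.symm h)]
  have hmul0 : ∀ x : Option ι → ℝ, Y.mulVec x none = y * x none + ∑ i, b i * x (some i) := by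
    intro x
    simp [Matrix.mulVec, dotProduct, Fintype.sum_option, Y]
  have hmul1 : ∀ (x : Option ι → ℝ) i,
      Y.mulVec x (some i) = b i * x none + u i * x (some i) := by
    intro x i
    simp [Matrix.mulVec, dotProduct, Fintype.sum_option, Y]
  have hquad : ∀ x : Option ι → ℝ, x ⬝ᵥ Y.mulVec x
      = ∑ i, (t * m i * (1 - u i) * x none ^ 2 + 2 * b i * x none * x (some i)
        + u i * x (some i) ^ 2) := by
    intro x
    rw [dotProduct, Fintype.sum_option, hmul0]
    simp_rw [hmul1]
    rw [mul_add, ← mul_assoc, mul_comm (x none) y, mul_assoc, Finset.sum_mul, Finset.mul_sum,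
      ← Finset.sum_add_distrib, ← Finset.sum_add_distrib]
    exact Finset.sum_congr rfl fun i _ => by ring
  obtain ⟨τ, hτ⟩ := exists_probabilityMeasure_resolvent hY (fun x => by
      rw [hquad]
      refine Finset.sum_nonneg fun i _ => ?_
      have h2 : b i = √(t * m i * (1 - u i)) * √(u i) := by
        rw [← Real.sqrt_mul (mul_nonneg (mul_nonneg ht0 (hm i)) (hu1 i))]
        simp only [b]
        congr 1; ring
      have h3 := Real.sq_sqrt (mul_nonneg (mul_nonneg ht0 (hm i)) (hu1 i))
      have h4 := Real.sq_sqrt (hu0 i)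
      calc 0 ≤ (√(t * m i * (1 - u i)) * x none + √(u i) * x (some i)) ^ 2 := sq_nonneg _
        _ = √(t * m i * (1 - u i)) ^ 2 * x none ^ 2
          + 2 * (√(t * m i * (1 - u i)) * √(u i)) * x none * x (some i)
          + √(u i) ^ 2 * x (some i) ^ 2 := by ring
        _ = _ := by rw [h3, h4, ← h2]) (fun x => by
      have hxx : x ⬝ᵥ x = (1 - t) * x none ^ 2 + ∑ i, (t * m i * x none ^ 2 + x (some i) ^ 2) := by
        rw [dotProduct, Fintype.sum_option, Finset.sum_add_distrib, ← Finset.sum_mul,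
          ← Finset.mul_sum, hm1]
        simp_rw [← sq]
        ring
      rw [hquad, hxx]
      refine le_trans ?_ (le_add_of_nonneg_left (mul_nonneg ht1 (sq_nonneg _)))
      refine Finset.sum_le_sum fun i _ => ?_
      have h2 : b i = √(t * m i * u i) * √(1 - u i) := by
        rw [← Real.sqrt_mul (mul_nonneg (mul_nonneg ht0 (hm i)) (hu0 i))]
      have h3 := Real.sq_sqrt (mul_nonneg (mul_nonneg ht0 (hm i)) (hu0 i))
      have h4 := Real.sq_sqrt (hu1 i)
      rw [← sub_nonneg]
      calc 0 ≤ (√(t * m i * u i) * x none - √(1 - u i) * x (some i)) ^ 2 := sq_nonneg _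
        _ = √(t * m i * u i) ^ 2 * x none ^ 2
          - 2 * (√(t * m i * u i) * √(1 - u i)) * x none * x (some i)
          + √(1 - u i) ^ 2 * x (some i) ^ 2 := by ring
        _ = _ := by rw [h3, h4, ← h2]; ring) none
  refine ⟨τ, fun c hc => ?_⟩
  set d : ℝ := 1 - t + t * (c * ∑ i, m i * stieltjesKernel c (u i)) with hd
  have hkpos : ∀ i, 0 < stieltjesKernel c (u i) := fun i =>
    inv_pos.2 (stieltjesKernel_denom_pos hc (u i))
  have hdpos : 0 < d := by
    have hs : 0 < ∑ i, m i * stieltjesKernel c (u i) := by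
      refine (Finset.sum_nonneg fun i _ => mul_nonneg (hm i) (hkpos i).le).lt_of_ne' fun h => ?_
      have := (Finset.sum_eq_zero_iff_of_nonneg fun i _ => mul_nonneg (hm i) (hkpos i).le).1 h
      have hz : ∑ i, m i = 0 := Finset.sum_eq_zero fun i hi =>
        (mul_eq_zero.1 (this i hi)).resolve_right (hkpos i).ne'
      rw [hm1] at hz
      exact one_ne_zero hz
    have := stieltjesKernel_denom_pos (mul_pos hc hs) t
    rw [hd]; linarith
  -- Block elimination: the lower rows give each x_i in terms of the corner entry, which is d⁻¹ by
  -- the top row.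
  let x : Option ι → ℝ := fun p =>
    p.elim d⁻¹ fun i => -((c - 1) * b i * stieltjesKernel c (u i)) * d⁻¹
  refine hτ c hc x ?_
  have hd' : d = 1 + (c - 1) * y - ∑ i, (c - 1) ^ 2 * b i ^ 2 * stieltjesKernel c (u i) := by
    have e1 : ∑ i, t * m i = t := by
      rw [← Finset.mul_sum, hm1, mul_one]
    have e2 : ∀ A : ℝ, 1 + (c - 1) * y - A = 1 - t + (∑ i, t * m i + (c - 1) * y - A) := by
      intro A; rw [e1]; ring
    rw [hd, e2]
    simp only [y, Finset.mul_sum]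
    rw [← Finset.sum_add_distrib, ← Finset.sum_sub_distrib]
    congr 1
    refine Finset.sum_congr rfl fun i _ => ?_
    rw [hb, stieltjesKernel]
    have := (stieltjesKernel_denom_pos hc (u i)).ne'
    field_simp
    ring
  funext p
  rcases p with _ | i
  · rw [Pi.add_apply, Pi.smul_apply, hmul0, Pi.single_eq_same]
    simp only [x, Option.elim, smul_eq_mul]
    have e2 : ∑ i, b i * (-((c - 1) * b i * stieltjesKernel c (u i)) * d⁻¹)
        = -(∑ i, (c - 1) * b i ^ 2 * stieltjesKernel c (u i)) * d⁻¹ := by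
      rw [← Finset.sum_neg_distrib, Finset.sum_mul]
      exact Finset.sum_congr rfl fun i _ => by ring
    have e3 : ∑ i, (c - 1) ^ 2 * b i ^ 2 * stieltjesKernel c (u i)
        = (c - 1) * ∑ i, (c - 1) * b i ^ 2 * stieltjesKernel c (u i) := by
      rw [Finset.mul_sum]
      exact Finset.sum_congr rfl fun i _ => by ring
    rw [e3] at hd'
    rw [e2]
    calc _ = (1 + (c - 1) * y - (c - 1) * ∑ i, (c - 1) * b i ^ 2 * stieltjesKernel c (u i))
          * d⁻¹ := by ring
      _ = 1 := by rw [← hd', mul_inv_cancel₀ hdpos.ne']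
  · rw [Pi.add_apply, Pi.smul_apply, hmul1, Pi.single_eq_of_ne (by simp)]
    simp only [x, Option.elim, smul_eq_mul, stieltjesKernel]
    have := (stieltjesKernel_denom_pos hc (u i)).ne'
    field_simp
    ring

theorem integral_stieltjesKernel_pos (σ : Measure unitInterval) [IsProbabilityMeasure σ] {c : ℝ}
    (hc : 0 < c) : 0 < ∫ u, stieltjesKernel c u ∂σ := by
  have hpos : ∀ u, 0 < stieltjesKernel c u := fun u => inv_pos.2 (stieltjesKernel_denom_pos hc u)
  rw [integral_pos_iff_support_of_nonneg (fun u => (hpos u).le)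
    (integrable_of_continuous_unitInterval (continuous_stieltjesKernel hc))]
  have : Function.support (stieltjesKernel c) = Set.univ := by
    ext u; simp [(hpos u).ne']
  rw [this, measure_univ]
  exact one_pos

theorem isStieltjesMean_inv (σ : Measure unitInterval) [IsProbabilityMeasure σ]
    (t : unitInterval) :
    IsStieltjesMean fun c => (1 - t + t * (c * ∫ u, stieltjesKernel c u ∂σ))⁻¹ := by
  classical
  obtain ⟨S, w, hw, hw1, hlim⟩ := exists_finite_approximation σ
  refine IsStieltjesMean.of_tendsto (F := fun n c =>
    (1 - (t : ℝ) + t * (c * ∑ y : S n, w n y * stieltjesKernel c y))⁻¹) (fun n => ?_)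
    fun c hc => ?_
  · refine isStieltjesMean_inv_of_finite (fun y : S n => hw n y) ?_ (fun y : S n => (y : unitInterval)) t
    rw [← hw1 n, ← Finset.sum_coe_sort (S n)]
  · have h1 := hlim _ (continuous_stieltjesKernel hc)
    have h2 := stieltjesKernel_denom_pos (mul_pos hc (integral_stieltjesKernel_pos σ hc)) t
    refine Tendsto.inv₀ ?_ (by linarith)
    refine tendsto_const_nhds.add ((Tendsto.const_mul c ?_).const_mul _)
    refine h1.congr fun n => ?_
    rw [← Finset.sum_coe_sort (S n)]

/-- The inverse square root of `c ∫ dσ(u) / (1 - u + c u)` is again a Stieltjes mean. -/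
theorem isStieltjesMean_rpow (σ : Measure unitInterval) [IsProbabilityMeasure σ] {a : ℝ}
    (h0 : 0 < a) (h1 : a < 1) :
    IsStieltjesMean fun c => (c * ∫ u, stieltjesKernel c u ∂σ) ^ (a - 1) := by
  have hpow := stieltjesIntegrable_powerMeasure h0 h1
  have hpow0 : powerMeasure a ≠ 0 := by
    intro h'
    have := stieltjesTransform_powerMeasure h0 h1 one_pos
    simp [h', stieltjesTransform] at this
  have := hpow.isProbabilityMeasure_rescaledMeasure hpow0 one_pos
  have hq : ∀ c : ℝ, 0 < c → 0 < c * ∫ u, stieltjesKernel c u ∂σ := fun c hc =>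
    mul_pos hc (integral_stieltjesKernel_pos σ hc)
  -- Evaluated at q > 0, the kernel formula for the power-law measure reads q^(a-1) = ∫ (1 - t +
  -- tq)⁻¹ over a probability measure in t, so the power is a mixture of reciprocals already
  -- treated.
  obtain ⟨τ, hτ⟩ := IsStieltjesMean.integral (rescaledMeasure (powerMeasure a) 1)
    (F := fun t c => (1 - (t : ℝ) + t * (c * ∫ u, stieltjesKernel c u ∂σ))⁻¹)
    (fun t => isStieltjesMean_inv σ t) (fun c hc => by
      refine (continuous_stieltjesKernel (hq c hc)).congr fun t => ?_
      rw [stieltjesKernel, mul_comm (t : ℝ)])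
  refine ⟨τ, fun c hc => ?_⟩
  refine Eq.trans ?_ (hτ c hc)
  have h2 := hpow.integral_stieltjesKernel_rescaledMeasure one_pos (hq c hc)
  rw [mul_one, stieltjesTransform_powerMeasure h0 h1 one_pos, Real.one_rpow, div_one,
    stieltjesTransform_powerMeasure h0 h1 (hq c hc)] at h2
  refine h2.symm.trans ?_
  refine integral_congr_ae (ae_of_all _ fun t => ?_)
  simp only [stieltjesKernel, mul_comm (t : ℝ)]

/-! ### From measures on [0, 1] back to spectral measures. -/

/-- The integral condition only sees (0, ∞); a possible atom at 0 is finite by local finiteness. -/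
theorem Viscoelastic.MemM.stieltjesIntegrable {μ : Measure ℝ} (h : Viscoelastic.MemM μ) :
    StieltjesIntegrable μ where
  null_neg := h.null_neg
  integrable := by
    have := h.locallyFinite
    have e : (Set.Iio (0 : ℝ) ∪ {0}) ∪ Set.Ioi 0 = Set.univ := by
      ext x; simp
    rw [← integrableOn_univ, ← e]
    refine IntegrableOn.union (IntegrableOn.union ?_ ?_) ?_
    · rw [IntegrableOn, Measure.restrict_eq_zero.2 h.null_neg]
      exact integrable_zero_measure
    · exact integrableOn_singleton (by simp)
        (isCompact_singleton.measure_lt_top)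
    · refine ⟨by fun_prop, ?_⟩
      rw [hasFiniteIntegral_iff_norm]
      refine lt_of_le_of_lt (le_of_eq ?_) h.lintegral_lt_top
      refine setLIntegral_congr_fun measurableSet_Ioi fun r hr => ?_
      have : 0 < 1 + r := by linarith [Set.mem_Ioi.1 hr]
      rw [Real.norm_of_nonneg (by positivity), one_div]

theorem setIntegral_Ioi_eq_stieltjesTransform {ν : Measure ℝ} (h : StieltjesIntegrable ν)
    (h0 : ν {0} = 0) (p : ℝ) :
    ∫ r in Set.Ioi (0 : ℝ), 1 / (p + r) ∂ν = stieltjesTransform ν p := by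
  have : ∀ᵐ r ∂ν, r ∈ Set.Ioi (0 : ℝ) := by
    have h1 : ∀ᵐ r ∂ν, r ≠ 0 := by rw [ae_iff]; simpa using h0
    filter_upwards [h.ae_nonneg, h1] with r hr hr0 using lt_of_le_of_ne hr hr0.symm
  rw [Measure.restrict_eq_self_of_ae_mem this]
  simp only [stieltjesTransform, one_div]

/-- The spectral measure on `(0, ∞)` obtained from a measure on `[0, 1]` by `r = (1 - u) / u`. -/
noncomputable def unfoldMeasure (K : ℝ) (τ : Measure unitInterval) : Measure ℝ :=
  ((τ.restrict {u : unitInterval | 0 < (u : ℝ) ∧ (u : ℝ) < 1}).withDensity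
    fun u => ENNReal.ofReal (K * (u : ℝ)⁻¹)).map fun u : unitInterval => (1 - (u : ℝ)) / u

section unfoldMeasure

variable {K : ℝ} {τ : Measure unitInterval}

theorem measurable_unfold : Measurable fun u : unitInterval => (1 - (u : ℝ)) / u := by fun_prop

theorem measurableSet_unitInterval_interior :
    MeasurableSet {u : unitInterval | 0 < (u : ℝ) ∧ (u : ℝ) < 1} :=
  (measurableSet_lt measurable_const measurable_subtype_coe).inter
    (measurableSet_lt measurable_subtype_coe measurable_const)

theorem lintegral_unfoldMeasure (f : ℝ → ENNReal) (hf : Measurable f) :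
    ∫⁻ r, f r ∂(unfoldMeasure K τ)
      = ∫⁻ u in {u : unitInterval | 0 < (u : ℝ) ∧ (u : ℝ) < 1},
        ENNReal.ofReal (K * (u : ℝ)⁻¹) * f ((1 - (u : ℝ)) / u) ∂τ := by
  rw [unfoldMeasure, lintegral_map hf measurable_unfold]
  exact lintegral_withDensity_eq_lintegral_mul _ (by fun_prop) (hf.comp measurable_unfold)

theorem unfoldMeasure_Iic_zero : unfoldMeasure K τ (Set.Iic 0) = 0 := by
  rw [unfoldMeasure, Measure.map_apply measurable_unfold measurableSet_Iic]
  refine withDensity_absolutelyContinuous _ _ ?_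
  rw [Measure.restrict_apply (measurable_unfold measurableSet_Iic)]
  convert measure_empty (μ := τ)
  ext u
  simp only [Set.mem_inter_iff, Set.mem_preimage, Set.mem_Iic, Set.mem_ofPred_eq,
    Set.mem_empty_iff_false, iff_false, not_and]
  rintro h h1 h2
  have : 0 < (1 - (u : ℝ)) / u := div_pos (by linarith) h1
  linarith

/-- The density K/u equals K(1 + r): it is bounded on bounded sets of r, and the weight (1 + r)⁻¹
reduces it to the constant K. -/
theorem memM_unfoldMeasure [IsFiniteMeasure τ] (hK : 0 ≤ K) :
    Viscoelastic.MemM (unfoldMeasure K τ) where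
  locallyFinite := by
    refine ⟨fun x => ⟨Set.Iio (max x 0 + 1), Iio_mem_nhds (by linarith [le_max_left x 0]), ?_⟩⟩
    rw [← lintegral_indicator_one measurableSet_Iio,
      lintegral_unfoldMeasure _ (measurable_one.indicator measurableSet_Iio)]
    refine lt_of_le_of_lt (b := ∫⁻ u, ENNReal.ofReal (K * (max x 0 + 2)) ∂τ) ?_ ?_
    · refine le_trans (lintegral_mono_ae ?_) (setLIntegral_le_lintegral _ _)
      filter_upwards [ae_restrict_mem measurableSet_unitInterval_interior] with u hu
      obtain ⟨h1, h2⟩ := hu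
      by_cases h : (1 - (u : ℝ)) / u < max x 0 + 1
      · rw [Set.indicator_of_mem (Set.mem_Iio.2 h), Pi.one_apply, mul_one]
        refine ENNReal.ofReal_le_ofReal (mul_le_mul_of_nonneg_left ?_ hK)
        have : (1 - (u : ℝ)) / u = (u : ℝ)⁻¹ - 1 := by field_simp
        linarith
      · rw [Set.indicator_of_notMem (by simpa using h), mul_zero]
        exact zero_le
    · rw [lintegral_const]
      exact ENNReal.mul_lt_top ENNReal.ofReal_lt_top (measure_lt_top _ _)
  null_neg := measure_mono_null Set.Iio_subset_Iic_self unfoldMeasure_Iic_zero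
  lintegral_lt_top := by
    refine lt_of_le_of_lt (setLIntegral_le_lintegral _ _) ?_
    rw [lintegral_unfoldMeasure _ (by fun_prop)]
    refine lt_of_le_of_lt (b := ∫⁻ u, ENNReal.ofReal K ∂τ) ?_ ?_
    · refine le_trans (lintegral_mono_ae ?_) (setLIntegral_le_lintegral _ _)
      filter_upwards [ae_restrict_mem measurableSet_unitInterval_interior] with u hu
      obtain ⟨h1, h2⟩ := hu
      rw [← ENNReal.ofReal_mul (by positivity)]
      refine le_of_eq ?_
      congr 1
      field_simp
      ring
    · rw [lintegral_const]
      exact ENNReal.mul_lt_top ENNReal.ofReal_lt_top (measure_lt_top _ _)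

theorem stieltjesTransform_unfoldMeasure (hK : 0 ≤ K) {p : ℝ} (hp : 0 < p) :
    stieltjesTransform (unfoldMeasure K τ) p
      = K * ∫ u in {u : unitInterval | 0 < (u : ℝ) ∧ (u : ℝ) < 1}, stieltjesKernel p u ∂τ := by
  rw [stieltjesTransform, unfoldMeasure, integral_map measurable_unfold.aemeasurable (by fun_prop),
    integral_withDensity_eq_integral_toReal_smul (by fun_prop)
    (ae_of_all _ fun _ => ENNReal.ofReal_lt_top), ← integral_const_mul]
  refine setIntegral_congr_fun measurableSet_unitInterval_interior fun u hu => ?_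
  obtain ⟨h1, h2⟩ := hu
  have h3 := stieltjesKernel_denom_pos hp u
  have h4 : p + (1 - (u : ℝ)) / u = (1 - u + p * u) / u := by field_simp; ring
  simp only [smul_eq_mul, stieltjesKernel]
  rw [ENNReal.toReal_ofReal (by positivity), h4, inv_div]
  field_simp

/-- Splitting off the atom at `u = 0`. -/
theorem integral_stieltjesKernel_eq_add [IsFiniteMeasure τ] (h1 : τ {1} = 0) {p : ℝ} (hp : 0 < p) :
    ∫ u, stieltjesKernel p u ∂τ = τ.real {0}
      + ∫ u in {u : unitInterval | 0 < (u : ℝ) ∧ (u : ℝ) < 1}, stieltjesKernel p u ∂τ := by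
  have hint : Integrable (stieltjesKernel p) τ :=
    integrable_of_continuous_unitInterval (continuous_stieltjesKernel hp)
  rw [← integral_add_compl (measurableSet_singleton (0 : unitInterval)) hint,
    integral_singleton]
  have hk : stieltjesKernel p 0 = 1 := by simp [stieltjesKernel]
  rw [hk, smul_eq_mul, mul_one]
  congr 1
  refine setIntegral_congr_set ?_
  have : ∀ᵐ u ∂τ, u ≠ 1 := by rw [ae_iff]; simpa using h1
  filter_upwards [this] with u hu
  refine propext ⟨fun h => ⟨?_, ?_⟩, fun h h0 => ?_⟩
  · exact lt_of_le_of_ne u.2.1 fun h' => h (Subtype.ext h'.symm)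
  · exact lt_of_le_of_ne u.2.2 fun h' => hu (Subtype.ext h')
  · rw [Set.mem_singleton_iff.1 h0] at h
    exact lt_irrefl _ h.1

end unfoldMeasure

/-! ### Representation of κ and blow-up of G. -/

namespace Viscoelastic

variable {μ : Measure ℝ} {G : ℝ → ℝ}

theorem relaxation_eq (hμ : MemM μ)
    (hG : ∀ t : ℝ, 0 < t → G t = ∫ r in Set.Ici (0 : ℝ), Real.exp (-(t * r)) ∂μ) {t : ℝ}
    (ht : 0 < t) : G t = ∫ r, Real.exp (-(t * r)) ∂μ := by
  rw [hG t ht, Measure.restrict_eq_self_of_ae_mem]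
  exact hμ.stieltjesIntegrable.ae_nonneg

theorem Q_eq (hμ : MemM μ)
    (hG : ∀ t : ℝ, 0 < t → G t = ∫ r in Set.Ici (0 : ℝ), Real.exp (-(t * r)) ∂μ) {p : ℝ}
    (hp : 0 < p) : Q G p = p * stieltjesTransform μ p := by
  have := hμ.locallyFinite
  rw [Q, laplace, ← hμ.stieltjesIntegrable.integral_exp_mul_exp hp]
  congr 1
  exact setIntegral_congr_fun measurableSet_Ioi fun t ht => by
    simp only [relaxation_eq hμ hG ht]

theorem Q_pos (hμ : MemM μ) (hμ0 : μ ≠ 0)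
    (hG : ∀ t : ℝ, 0 < t → G t = ∫ r in Set.Ici (0 : ℝ), Real.exp (-(t * r)) ∂μ) {p : ℝ}
    (hp : 0 < p) : 0 < Q G p := by
  rw [Q_eq hμ hG hp]
  exact mul_pos hp (hμ.stieltjesIntegrable.stieltjesTransform_pos hμ0 hp)

theorem kappa_eq_rpow (hμ : MemM μ) (hμ0 : μ ≠ 0)
    (hG : ∀ t : ℝ, 0 < t → G t = ∫ r in Set.Ici (0 : ℝ), Real.exp (-(t * r)) ∂μ) (ρ : ℝ) {p : ℝ}
    (hp : 0 < p) : kappa ρ G p = p * (√ρ * Q G p ^ (-1 / 2 : ℝ)) := by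
  have h := Q_pos hμ hμ0 hG hp
  have e : (-1 / 2 : ℝ) = -(1 / 2) := by norm_num
  rw [kappa, e, Real.rpow_neg h.le, ← Real.sqrt_eq_rpow]
  ring

/-- The wave number function of a medium with relaxation spectral measure in `𝔐` is represented
by a dispersion-attenuation spectral measure. -/
theorem exists_isWaveNumberRep (hμ : MemM μ) (hμ0 : μ ≠ 0)
    (hG : ∀ t : ℝ, 0 < t → G t = ∫ r in Set.Ici (0 : ℝ), Real.exp (-(t * r)) ∂μ) (ρ : ℝ) :
    ∃ (B : ℝ) (ν : Measure ℝ), IsWaveNumberRep ρ G B ν := by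
  have h := hμ.stieltjesIntegrable
  have hprob := h.isProbabilityMeasure_rescaledMeasure hμ0 one_pos
  obtain ⟨τ, hτ⟩ := isStieltjesMean_rpow (rescaledMeasure μ 1) (a := 1 / 2) (by norm_num)
    (by norm_num)
  have hS1 := h.stieltjesTransform_pos hμ0 one_pos
  let K : ℝ := √ρ * stieltjesTransform μ 1 ^ (-1 / 2 : ℝ)
  have hK : 0 ≤ K := by positivity
  have hkappa : ∀ p : ℝ, 0 < p →
      kappa ρ G p = p * (K * ∫ u, stieltjesKernel p u ∂(τ : Measure unitInterval)) := by
    intro p hp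
    have hq := mul_pos hp (integral_stieltjesKernel_pos (rescaledMeasure μ 1) hp)
    rw [kappa_eq_rpow hμ hμ0 hG ρ hp, ← hτ p hp, Q_eq hμ hG hp]
    have e : p * stieltjesTransform μ p = stieltjesTransform μ 1
        * (p * ∫ u, stieltjesKernel p u ∂(rescaledMeasure μ 1)) := by
      rw [h.integral_stieltjesKernel_rescaledMeasure one_pos hp, mul_one]
      field_simp
    have e' : (1 / 2 - 1 : ℝ) = -1 / 2 := by norm_num
    simp only
    rw [e, Real.mul_rpow hS1.le hq.le, e']
    simp only [K]
    ring
  -- An atom at u = 1 would become mass of ν at r = 0. It would add τ{1}/c to the mean, but the mean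
  -- is at most c^(-1/2) for c < 1, so τ{1} ≤ √c → 0.
  have hτ1 : (τ : Measure unitInterval) {1} = 0 := by
    have hle : ∀ c ∈ Set.Ioo (0 : ℝ) 1, (τ : Measure unitInterval).real {1} ≤ √c := by
      rintro c ⟨hc0, hc1⟩
      have hk1 : ∀ u : unitInterval, 1 ≤ stieltjesKernel c u := fun u => by
        refine (one_le_inv₀ (stieltjesKernel_denom_pos hc0 u)).2 ?_
        have := u.2.1
        nlinarith
      have hI : 1 ≤ ∫ u, stieltjesKernel c u ∂(rescaledMeasure μ 1) := by
        have := integral_mono (μ := rescaledMeasure μ 1) (integrable_const (1 : ℝ))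
          (integrable_of_continuous_unitInterval (continuous_stieltjesKernel hc0)) hk1
        simpa using this
      have h1 : c⁻¹ * (τ : Measure unitInterval).real {1}
          ≤ ∫ u, stieltjesKernel c u ∂(τ : Measure unitInterval) := by
        have e : c⁻¹ * (τ : Measure unitInterval).real {1}
            = ∫ u in {1}, stieltjesKernel c u ∂(τ : Measure unitInterval) := by
          rw [integral_singleton, smul_eq_mul, mul_comm]
          simp [stieltjesKernel]
        rw [e]
        exact setIntegral_le_integral
          (integrable_of_continuous_unitInterval (continuous_stieltjesKernel hc0))
          (ae_of_all _ fun u => zero_le_one.trans (hk1 u))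
      rw [← hτ c hc0] at h1
      have h2 : (c * ∫ u, stieltjesKernel c u ∂(rescaledMeasure μ 1)) ^ (1 / 2 - 1 : ℝ)
          ≤ c ^ (1 / 2 - 1 : ℝ) :=
        Real.rpow_le_rpow_of_nonpos hc0 (le_mul_of_one_le_right hc0.le hI) (by norm_num)
      have h3 := h1.trans h2
      rw [inv_mul_le_iff₀ hc0] at h3
      refine h3.trans (le_of_eq ?_)
      rw [Real.sqrt_eq_rpow]
      nth_rewrite 1 [← Real.rpow_one c]
      rw [← Real.rpow_add hc0]
      norm_num
    have hlim : Tendsto (fun c : ℝ => √c) (𝓝[>] 0) (𝓝 0) := by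
      have := (Real.continuous_sqrt.tendsto 0).mono_left (nhdsWithin_le_nhds (s := Set.Ioi 0))
      simpa using this
    have h0 : (τ : Measure unitInterval).real {1} ≤ 0 :=
      ge_of_tendsto hlim (by
        filter_upwards [Ioo_mem_nhdsGT (zero_lt_one (α := ℝ))] with c hc using hle c hc)
    exact (measureReal_eq_zero_iff).1 (le_antisymm h0 measureReal_nonneg)
  -- The kernel equals 1 at u = 0, that is r = ∞, so the atom there produces the linear term B p.
  refine ⟨K * (τ : Measure unitInterval).real {0}, unfoldMeasure K τ,
    mul_nonneg hK measureReal_nonneg, memM_unfoldMeasure hK,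
    measure_mono_null (by simp) unfoldMeasure_Iic_zero, fun p hp => ?_⟩
  rw [setIntegral_Ioi_eq_stieltjesTransform (memM_unfoldMeasure hK).stieltjesIntegrable
    (measure_mono_null (by simp) unfoldMeasure_Iic_zero), stieltjesTransform_unfoldMeasure hK hp,
    hkappa p hp, integral_stieltjesKernel_eq_add hτ1 hp]
  ring

/-- On [0, 1/t] the exponential is at least e⁻¹, so G(t) ≥ e⁻¹ μ([0, 1/t]). -/
theorem tendsto_relaxation_atTop (hμ : MemM μ)
    (hG : ∀ t : ℝ, 0 < t → G t = ∫ r in Set.Ici (0 : ℝ), Real.exp (-(t * r)) ∂μ)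
    (hF : Tendsto (fun r => μ.real (Set.Icc 0 r)) atTop atTop) :
    Tendsto G (𝓝[>] 0) atTop := by
  have h := hμ.stieltjesIntegrable
  have hF' : Tendsto (fun t : ℝ => Real.exp (-1) * μ.real (Set.Icc 0 t⁻¹)) (𝓝[>] 0) atTop :=
    (hF.comp tendsto_inv_nhdsGT_zero).const_mul_atTop (Real.exp_pos _)
  refine tendsto_atTop_mono' _ ?_ hF'
  filter_upwards [self_mem_nhdsWithin] with t ht
  have ht : 0 < t := ht
  have hint : Integrable (fun r => Real.exp (-(t * r))) μ := by
    refine ((h.integrable_inv_add (inv_pos.2 ht)).const_mul t⁻¹).mono' (by fun_prop) ?_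
    filter_upwards [h.ae_nonneg] with r hr
    rw [Real.norm_of_nonneg (by positivity), Real.exp_neg, ← mul_inv]
    refine inv_anti₀ (by positivity) ?_
    have := Real.add_one_le_exp (t * r)
    have e : t * (t⁻¹ + r) = t * r + 1 := by field_simp; ring
    rwa [e]
  rw [relaxation_eq hμ hG ht]
  calc Real.exp (-1) * μ.real (Set.Icc 0 t⁻¹)
      = ∫ r in Set.Icc 0 t⁻¹, Real.exp (-1) ∂μ := by
        rw [setIntegral_const, smul_eq_mul, mul_comm]
    _ ≤ ∫ r in Set.Icc 0 t⁻¹, Real.exp (-(t * r)) ∂μ := by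
        refine setIntegral_mono_on (integrableOn_const (h.measure_Icc_lt_top _).ne)
          hint.integrableOn measurableSet_Icc fun r hr => ?_
        refine Real.exp_le_exp.2 (neg_le_neg ?_)
        calc t * r ≤ t * t⁻¹ := by gcongr; exact hr.2
          _ = 1 := mul_inv_cancel₀ ht.ne'
    _ ≤ _ := setIntegral_le_integral hint (ae_of_all _ fun r => (Real.exp_pos _).le)

end Viscoelastic

/-! ### Asymptotic equivalence and the main theorem. -/

theorem isEquivalent_rpow {f g : ℝ → ℝ} (h : f ~[atTop] g) (hg : ∀ᶠ x in atTop, 0 < g x)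
    (b : ℝ) : (fun x => f x ^ b) ~[atTop] fun x => g x ^ b := by
  have h1 := (isEquivalent_iff_tendsto_one (hg.mono fun x hx => hx.ne')).1 h
  refine isEquivalent_of_tendsto_one ?_
  have h2 := h1.rpow_const (p := b) (Or.inl one_ne_zero)
  rw [Real.one_rpow] at h2
  refine h2.congr' ?_
  filter_upwards [hg, h1.eventually_const_lt zero_lt_one] with x hx hfx
  have hf : 0 < f x := (div_pos_iff_of_pos_right hx).1 hfx
  exact Real.div_rpow hf.le hx.le b

theorem isEquivalent_of_tendsto_div {f g : ℝ → ℝ} {k : ℝ} (hk : k ≠ 0)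
    (hg : ∀ᶠ x in atTop, g x ≠ 0) (h : Tendsto (fun x => f x / g x) atTop (𝓝 k)) :
    f ~[atTop] fun x => k * g x := by
  refine isEquivalent_of_tendsto_one ?_
  have := h.div_const k
  rw [div_self hk] at this
  refine this.congr' ?_
  filter_upwards [hg] with x hx
  simp only [Pi.div_apply]
  field_simp

theorem mainTheorem8 (α γ ρ : ℝ) (hα₀ : 0 < α) (hα₁ : α < 1) (hγ : γ = 1 - α / 2) (hρ : 0 < ρ)
    (l : ℝ → ℝ) (hl : Viscoelastic.SlowlyVaryingAtTop l)
    (μ : Measure ℝ) (hμ : Viscoelastic.MemM μ)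
    (hμl : (fun r : ℝ => μ.real (Set.Icc 0 r)) ~[atTop] (fun r : ℝ => r ^ α * l r))
    (G : ℝ → ℝ)
    (hG : ∀ t : ℝ, 0 < t → G t = ∫ r in Set.Ici (0 : ℝ), Real.exp (-(t * r)) ∂μ) :
    -- the limit of `G` at `0+` is infinite
    Tendsto G (𝓝[>] 0) atTop ∧
    -- asymptotics of `Q` and of `κ`
    (fun p : ℝ => Viscoelastic.Q G p) ~[atTop]
      (fun p : ℝ => Viscoelastic.cst α * p ^ α * l p) ∧
    (fun p : ℝ => Viscoelastic.kappa ρ G p) ~[atTop]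
      (fun p : ℝ => ρ ^ (1 / 2 : ℝ) * Viscoelastic.cst α ^ (-1 / 2 : ℝ) * p ^ γ
        * l p ^ (-1 / 2 : ℝ)) ∧
    1 / 2 < γ ∧ γ < 1 ∧
    -- `B` and the dispersion-attenuation spectral measure exist, and whatever pair represents `κ`,
    -- the wavefront speed is infinite and `ν` is regularly varying
    (∃ (B : ℝ) (ν : Measure ℝ), Viscoelastic.IsWaveNumberRep ρ G B ν) ∧
    ∀ (B : ℝ) (ν : Measure ℝ), Viscoelastic.IsWaveNumberRep ρ G B ν →
      Viscoelastic.wavefrontSpeed B = ⊤ ∧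
      (fun r : ℝ => ν.real (Set.Icc 0 r)) ~[atTop]
        (fun r : ℝ => ρ ^ (1 / 2 : ℝ) * Viscoelastic.cst α ^ (-1 / 2 : ℝ)
          * (Viscoelastic.cst γ)⁻¹ * r ^ γ * l r ^ (-1 / 2 : ℝ)) := by
  have hμS := hμ.stieltjesIntegrable
  have hfin := hμ.locallyFinite
  have hFrv : RegularlyVarying (fun r => μ.real (Set.Icc 0 r)) α :=
    (RegularlyVarying.rpow_mul hl α).of_isEquivalent hμl
  have hFpos : ∀ᶠ x in atTop, 0 < μ.real (Set.Icc 0 x) :=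
    hFrv.eventually_ne_zero.mono fun x hx => lt_of_le_of_ne measureReal_nonneg hx.symm
  have hFtop := hFrv.tendsto_atTop_of_monotone hμS.measureReal_Icc_mono hFpos hα₀
  have hμ0 : μ ≠ 0 := by
    rintro rfl
    obtain ⟨x, hx⟩ := hFpos.exists
    simp at hx
  have hcα := cst_pos hα₀ hα₁
  have hγ0 : 1 / 2 < γ := by linarith
  have hγ1 : γ < 1 := by linarith
  have hcγ := cst_pos (by linarith) hγ1
  have hlne := (RegularlyVarying.rpow_mul hl α).eventually_ne_zero
  -- Positivity of l is not assumed; it follows eventually from equivalence with a nonnegative,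
  -- eventually nonzero distribution function.
  have hlpos : ∀ᶠ x in atTop, 0 < x ^ α * l x := by
    filter_upwards [hFpos, ((isEquivalent_iff_tendsto_one hlne).1 hμl).eventually_const_lt
      zero_lt_one] with x hx hx'
    exact (div_pos_iff_of_pos_left hx).1 hx'
  -- asymptotics of `Q`
  have hQF : Tendsto (fun p => Viscoelastic.Q G p / μ.real (Set.Icc 0 p)) atTop
      (𝓝 (Viscoelastic.cst α)) := by
    refine (hμS.tendsto_mul_stieltjesTransform_div hα₀ hα₁ hFrv).congr' ?_
    filter_upwards [eventually_gt_atTop 0] with p hp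
    rw [Viscoelastic.Q_eq hμ hG hp]
  have hQ : (fun p : ℝ => Viscoelastic.Q G p) ~[atTop]
      (fun p : ℝ => Viscoelastic.cst α * p ^ α * l p) := by
    have h1 := (isEquivalent_of_tendsto_div hcα.ne' hFrv.eventually_ne_zero hQF).trans
      ((IsEquivalent.refl (u := fun _ : ℝ => Viscoelastic.cst α)).mul hμl)
    refine h1.congr_right (Eventually.of_forall fun p => ?_)
    simp only [Pi.mul_apply, mul_assoc]
  have hQrv : RegularlyVarying (Viscoelastic.Q G) α := hFrv.of_tendsto_div hcα.ne' hQF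
  have hQpos : ∀ᶠ p in atTop, 0 < Viscoelastic.Q G p := by
    filter_upwards [eventually_gt_atTop 0] with p hp using Viscoelastic.Q_pos hμ hμ0 hG hp
  have hQtop : Tendsto (Viscoelastic.Q G) atTop atTop := by
    refine (hQF.pos_mul_atTop hcα hFtop).congr' ?_
    filter_upwards [hFpos] with p hp
    field_simp
  -- asymptotics of `κ`
  have hκ : (fun p : ℝ => Viscoelastic.kappa ρ G p) ~[atTop]
      (fun p : ℝ => ρ ^ (1 / 2 : ℝ) * Viscoelastic.cst α ^ (-1 / 2 : ℝ) * p ^ γ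
        * l p ^ (-1 / 2 : ℝ)) := by
    have hqpos : ∀ᶠ p in atTop, 0 < Viscoelastic.cst α * p ^ α * l p := by
      filter_upwards [hlpos] with p hp
      rw [mul_assoc]; positivity
    have h1 := (IsEquivalent.refl (u := fun p : ℝ => p * √ρ) (l := atTop)).mul
      (isEquivalent_rpow hQ hqpos (-1 / 2))
    refine (h1.congr_left ?_).congr_right ?_
    · filter_upwards [eventually_gt_atTop 0] with p hp
      rw [Viscoelastic.kappa_eq_rpow hμ hμ0 hG ρ hp]
      simp only [Pi.mul_apply, mul_assoc]
    · filter_upwards [eventually_gt_atTop 0, hlpos] with p hp hlp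
      have hpα := Real.rpow_pos_of_pos hp α
      have hlp' : 0 < l p := (mul_pos_iff_of_pos_left hpα).1 hlp
      have e : p ^ γ = p * (p ^ α) ^ (-1 / 2 : ℝ) := by
        rw [← Real.rpow_mul hp.le]
        nth_rewrite 2 [← Real.rpow_one p]
        rw [← Real.rpow_add hp, hγ]
        congr 1; ring
      simp only [Pi.mul_apply]
      rw [Real.mul_rpow (by positivity) hlp'.le, Real.mul_rpow hcα.le hpα.le, e,
        Real.sqrt_eq_rpow]
      ring
  refine ⟨Viscoelastic.tendsto_relaxation_atTop hμ hG hFtop, hQ, hκ, hγ0, hγ1,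
    Viscoelastic.exists_isWaveNumberRep hμ hμ0 hG ρ, fun B ν hν => ?_⟩
  have hνS := hν.memM.stieltjesIntegrable
  have hrep : ∀ p : ℝ, 0 < p → √ρ * Viscoelastic.Q G p ^ (-1 / 2 : ℝ)
      = B + stieltjesTransform ν p := by
    intro p hp
    have h1 := hν.kappa_eq p hp
    rw [Viscoelastic.kappa_eq_rpow hμ hμ0 hG ρ hp,
      setIntegral_Ioi_eq_stieltjesTransform hνS hν.null_zero] at h1
    refine mul_left_cancel₀ hp.ne' (h1.trans ?_)
    ring
  have hB : B = 0 := by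
    have h1 : Tendsto (fun p => √ρ * Viscoelastic.Q G p ^ (-1 / 2 : ℝ)) atTop (𝓝 0) := by
      have e : (-1 / 2 : ℝ) = -(1 / 2) := by norm_num
      have := ((tendsto_rpow_neg_atTop (y := 1 / 2) (by norm_num)).comp hQtop).const_mul √ρ
      rw [mul_zero] at this
      rw [e]
      exact this
    refine le_antisymm (ge_of_tendsto h1 ?_) hν.nonneg
    filter_upwards [eventually_gt_atTop 0] with p hp
    rw [hrep p hp]
    linarith [hνS.stieltjesTransform_nonneg hp]
  subst hB
  simp only [zero_add] at hrep
  have hρ' : 0 < √ρ := Real.sqrt_pos.2 hρ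
  have hν0 : ν ≠ 0 := by
    rintro rfl
    have h1 := hrep 1 one_pos
    have h2 := Real.rpow_pos_of_pos (Viscoelastic.Q_pos hμ hμ0 hG one_pos) (-1 / 2 : ℝ)
    have h3 : 0 < √ρ * Viscoelastic.Q G 1 ^ (-1 / 2 : ℝ) := by positivity
    rw [h1] at h3
    simp [stieltjesTransform] at h3
  have hT : RegularlyVarying (stieltjesTransform ν) (γ - 1) := by
    have h1 := (hQrv.rpow hQpos (-1 / 2)).const_mul hρ'.ne'
    have e : α * (-1 / 2) = γ - 1 := by rw [hγ]; ring
    rw [e] at h1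
    refine h1.of_isEquivalent (EventuallyEq.isEquivalent ?_)
    filter_upwards [eventually_gt_atTop 0] with p hp using (hrep p hp).symm
  refine ⟨by simp [Viscoelastic.wavefrontSpeed], ?_⟩
  -- Since B = 0, x S_ν(x) = κ(x), so the Tauberian theorem compares ν([0, x]) with κ(x) directly.
  have hN : Tendsto (fun x => ν.real (Set.Icc 0 x) / Viscoelastic.kappa ρ G x) atTop
      (𝓝 (Viscoelastic.cst γ)⁻¹) := by
    refine (hνS.tendsto_measureReal_div hν0 (by linarith) hγ1 hT).congr' ?_
    filter_upwards [eventually_gt_atTop 0] with p hp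
    rw [← hrep p hp, Viscoelastic.kappa_eq_rpow hμ hμ0 hG ρ hp]
  have hκne : ∀ᶠ p in atTop, Viscoelastic.kappa ρ G p ≠ 0 := by
    filter_upwards [eventually_gt_atTop 0] with p hp
    rw [Viscoelastic.kappa_eq_rpow hμ hμ0 hG ρ hp]
    have := Real.rpow_pos_of_pos (Viscoelastic.Q_pos hμ hμ0 hG hp) (-1 / 2 : ℝ)
    positivity
  have h1 := (isEquivalent_of_tendsto_div (inv_ne_zero hcγ.ne') hκne hN).trans
    ((IsEquivalent.refl (u := fun _ : ℝ => (Viscoelastic.cst γ)⁻¹)).mul hκ)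
  refine h1.congr_right (Eventually.of_forall fun p => ?_)
  simp only [Pi.mul_apply]
  ring
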